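/- Let $\mathbb T=\{z\in\mathbb C: |z|=1\}$. **Twisted group von Neumann algebras.** A normalized scalar 2-cocycle of an abelian group $\Gamma$ is a map $\mu:\Gamma\times\Gamma\to\mathbb T$ with $\mu(g,h)\mu(g+h,k)=\mu(h,k)\mu(g,h+k)$ and $\mu(g,0)=1=\mu(0,g)$ for all $g,h,k\in\Gamma$. Two such cocycles $\mu,\nu$ are cohomologous if there is a map $b:\Gamma\to\mathbb T$ with $\mu(g,h)=b(g)\,b(h)\,\overline{b(g+h)}\,\nu(g,h)$ for all $g,h$. The algebra $L_\mu(\Gamma)$ is the von Neumann algebra on $\ell^2(\Gamma)$ generated by the unitaries $u_\gamma$, $\gamma\in\Gamma$, with $u_\gamma\delta_g=\mu(\gamma,g)\,\delta_{\gamma+g}$. **Twisted Bernoulli shifts.** Let $H$ be a countable abelian group, $\mu$ a normalized scalar 2-cocycle of $H$ and $\chi:H\to\mathbb T$ a character. Put $$\Lambda(H)=\Big\{\lambda:\mathbb Z^2\to H \;:\; \lambda \text{ finitely supported},\ \sum_{k\in\mathbb Z^2}\lambda(k)=0\Big\},\qquad \widetilde\mu(\lambda_1,\lambda_2)=\prod_{k\in\mathbb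 Z^2}\mu(\lambda_1(k),\lambda_2(k)),$$ and $N(H,\mu)=L_{\widetilde\mu}(\Lambda(H))$, with canonical unitaries $u(\lambda)$, $\lambda\in\Lambda(H)$. The group $\mathbb Z^2\rtimes \mathrm{SL}(2,\mathbb Z)$ acts on $\mathbb Z^2$ by $(k,\gamma)\cdot m=k+\gamma m$ and on $\Lambda(H)$ by $(g\cdot\lambda)(m)=\lambda(g^{-1}\cdot m)$. With $\det\big((q,r),(q_0,r_0)\big)=qr_0-rq_0$, the twisted Bernoulli shift $\beta(H,\mu,\chi)$ is the action of $\mathbb Z^2\rtimes \mathrm{SL}(2,\mathbb Z)$ on $N(H,\mu)$ by trace-preserving $*$-automorphisms determined by $$\beta(k,\gamma)(u(\lambda))=\Big(\prod_{m\in\mathbb Z^2}\chi\big((\gamma\cdot\lambda)(m)\big)^{\det(k,m)}\Big)\,u\big((k,\gamma)\cdot\lambda\big).$$ **Theorem 4.1.** Let $H_a,H_b$ be countable abelian groups, let $\mu_a,\mu_b$ be normalized scalar 2-cocycles and $\chi_a,\chi_b$ characters of $H_a$, $H_b$ respectively, and put $\beta_a=\beta(H_a,\mu_a,\chi_a)$,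 $\beta_b=\beta(H_b,\mu_b,\chi_b)$. Write $u(\lambda)\in N(H_a,\mu_a)$ and $v(\sigma)\in N(H_b,\mu_b)$ for the canonical unitaries. If $\pi:N(H_a,\mu_a)\to N(H_b,\mu_b)$ is a $*$-isomorphism with $\pi\circ\beta_a(g)=\beta_b(g)\circ\pi$ for all $g\in\mathbb Z^2\rtimes \mathrm{SL}(2,\mathbb Z)$, then there is a group isomorphism $\varphi:H_a\to H_b$ such that 1. for every $\lambda\in\Lambda(H_a)$ there is $c\in\mathbb T$ with $\pi(u(\lambda))=c\,v(\varphi\circ\lambda)$; 2. the 2-cocycles $\mu_a(\cdot,\cdot)$ and $\mu_b(\varphi(\cdot),\varphi(\cdot))$ of $H_a$ are cohomologous; 3. $\chi_a^2=(\chi_b\circ\varphi)^2$. Conversely, for every group isomorphism $\varphi:H_a\to H_b$ satisfying (2) and (3) there is a $*$-isomorphism $\pi:N(H_a,\mu_a)\to N(H_b,\mu_b)$ which satisfies (1) and $\pi\circ\beta_a(g)=\beta_b(g)\circ\pi$ for all $g\in\mathbb Z^2\rtimes \mathrm{SL}(2,\mathbb Z)$. -/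

import Mathlib

open scoped Matrix MatrixGroups

noncomputable section

namespace TwistedBernoulli

/-! ### Scalar `2`-cocycles -/

/-- A normalized scalar `2`-cocycle `μ : Γ × Γ → 𝕋` of an abelian group `Γ`. -/
structure Cocycle (Γ : Type*) [AddCommGroup Γ] where
  toFun : Γ → Γ → Circle
  cocycle' : ∀ g h k, toFun g h * toFun (g + h) k = toFun h k * toFun g (h + k)
  zero_left' : ∀ g, toFun 0 g = 1
  zero_right' : ∀ g, toFun g 0 = 1

instance {Γ : Type*} [AddCommGroup Γ] : CoeFun (Cocycle Γ) (fun _ => Γ → Γ → Circle) :=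
  ⟨Cocycle.toFun⟩

/-- Two `𝕋`-valued functions of two variables are cohomologous if they differ by a coboundary
`(g, h) ↦ b(g) b(h) b(g + h)⁻¹`. -/
def Cohomologous {Γ : Type*} [AddCommGroup Γ] (μ ν : Γ → Γ → Circle) : Prop :=
  ∃ b : Γ → Circle, ∀ g h, μ g h = b g * b h * (b (g + h))⁻¹ * ν g h

/-! ### Monomial unitaries on `ℓ²` -/

/-- The Hilbert space `ℓ²(Γ)`. -/
abbrev L2 (Γ : Type*) : Type _ := lp (fun _ : Γ => ℂ) 2

theorem memLp_monomial {Γ : Type*} (e : Equiv.Perm Γ) (c : Γ → Circle) (f : L2 Γ) :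
    Memℓp (fun x => (c (e.symm x) : ℂ) * f (e.symm x)) 2 := by
  have hf := lp.memℓp f
  rw [memℓp_gen_iff (by norm_num)] at hf ⊢
  simp only [norm_mul, Circle.norm_coe, one_mul]
  exact (e.symm.summable_iff (f := fun i => ‖f i‖ ^ (2 : ENNReal).toReal)).2 hf

/-- The linear isometry of `ℓ²(Γ)` with `δ_g ↦ c(g) δ_{e(g)}`, for a permutation `e` of `Γ` and a
function `c : Γ → 𝕋`. -/
def monomialIsometry {Γ : Type*} (e : Equiv.Perm Γ) (c : Γ → Circle) : L2 Γ →ₗᵢ[ℂ] L2 Γ where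
  toFun f := ⟨fun x => (c (e.symm x) : ℂ) * f (e.symm x), memLp_monomial e c f⟩
  map_add' f g := by
    ext x
    exact mul_add _ _ _
  map_smul' a f := by
    ext x
    exact mul_left_comm _ _ _
  norm_map' f := by
    have h : (0 : ℝ) < (2 : ENNReal).toReal := by norm_num
    refine (Real.rpow_left_injOn h.ne').eq_iff (norm_nonneg _) (norm_nonneg _) |>.1 ?_
    dsimp only
    rw [lp.norm_rpow_eq_tsum h, lp.norm_rpow_eq_tsum h]
    simp only [LinearMap.coe_mk, AddHom.coe_mk, norm_mul, Circle.norm_coe, one_mul]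
    exact e.symm.tsum_eq (fun i => ‖f i‖ ^ (2 : ENNReal).toReal)

theorem monomialIsometry_apply {Γ : Type*} (e : Equiv.Perm Γ) (c : Γ → Circle) (f : L2 Γ) (x : Γ) :
    monomialIsometry e c f x = (c (e.symm x) : ℂ) * f (e.symm x) := rfl

/-- The unitary of `ℓ²(Γ)` with `δ_g ↦ c(g) δ_{e(g)}`. -/
def monomial {Γ : Type*} (e : Equiv.Perm Γ) (c : Γ → Circle) : unitary (L2 Γ →L[ℂ] L2 Γ) :=
  Unitary.linearIsometryEquiv.symm
    (LinearIsometryEquiv.ofSurjective (monomialIsometry e c) (fun f => by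
      refine ⟨monomialIsometry e.symm (fun x => (c (e.symm x))⁻¹) f, ?_⟩
      ext x
      simp [monomialIsometry_apply]))

theorem monomial_apply {Γ : Type*} (e : Equiv.Perm Γ) (c : Γ → Circle) (f : L2 Γ) (x : Γ) :
    (monomial e c : L2 Γ →L[ℂ] L2 Γ) f x = (c (e.symm x) : ℂ) * f (e.symm x) := rfl

theorem monomial_single {Γ : Type*} [DecidableEq Γ] (e : Equiv.Perm Γ) (c : Γ → Circle) (g : Γ) :
    (monomial e c : L2 Γ →L[ℂ] L2 Γ) (lp.single 2 g (1 : ℂ)) = (c g : ℂ) • lp.single 2 (e g) 1 := by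
  ext x
  rw [monomial_apply]
  by_cases h : x = e g
  · subst h
    simp
  · have h' : e.symm x ≠ g := fun h' => h (by simp [← h'])
    simp [h, h']

theorem monomial_mul {Γ : Type*} (e₁ e₂ : Equiv.Perm Γ) (c₁ c₂ : Γ → Circle) :
    monomial e₁ c₁ * monomial e₂ c₂ = monomial (e₁ * e₂) (fun x => c₁ (e₂ x) * c₂ x) := by
  refine Subtype.ext (ContinuousLinearMap.ext fun f => lp.ext (funext fun x => ?_))
  simp only [Submonoid.coe_mul, mul_apply_eq_comp, monomial_apply]
  simp [Equiv.Perm.mul_def, mul_assoc]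

theorem monomial_one {Γ : Type*} : monomial (1 : Equiv.Perm Γ) (fun _ => 1) = 1 := by
  refine Subtype.ext (ContinuousLinearMap.ext fun f => lp.ext (funext fun x => ?_))
  rw [monomial_apply]
  simp [Equiv.Perm.one_def]

/-! ### Twisted group von Neumann algebras -/

section TwistedVN

variable {Γ : Type*} [AddCommGroup Γ]

/-- The twisted left translation `u_γ` on `ℓ²(Γ)`, `u_γ δ_g = μ(γ, g) δ_{γ + g}`. -/
def Cocycle.translation (μ : Cocycle Γ) (γ : Γ) : unitary (L2 Γ →L[ℂ] L2 Γ) :=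
  monomial (Equiv.addLeft γ) (μ γ)

/-- The set of all twisted translations, as bounded operators on `ℓ²(Γ)`. -/
def Cocycle.translations (μ : Cocycle Γ) : Set (L2 Γ →L[ℂ] L2 Γ) :=
  Set.range fun γ => (μ.translation γ : L2 Γ →L[ℂ] L2 Γ)

/-- The twisted group von Neumann algebra `L_μ(Γ)`: the von Neumann algebra on `ℓ²(Γ)` generated by
the twisted translations, that is, their double commutant. -/
def Cocycle.vN (μ : Cocycle Γ) : VonNeumannAlgebra (L2 Γ) where
  toStarSubalgebra := StarSubalgebra.centralizer ℂ
    (StarSubalgebra.centralizer ℂ μ.translations : Set (L2 Γ →L[ℂ] L2 Γ))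
  centralizer_centralizer' := by
    change Set.centralizer (Set.centralizer ((StarSubalgebra.centralizer ℂ
        (StarSubalgebra.centralizer ℂ μ.translations : Set (L2 Γ →L[ℂ] L2 Γ)) :
          StarSubalgebra ℂ (L2 Γ →L[ℂ] L2 Γ)) : Set (L2 Γ →L[ℂ] L2 Γ))) =
      ((StarSubalgebra.centralizer ℂ (StarSubalgebra.centralizer ℂ μ.translations :
        Set (L2 Γ →L[ℂ] L2 Γ)) : StarSubalgebra ℂ (L2 Γ →L[ℂ] L2 Γ)) : Set (L2 Γ →L[ℂ] L2 Γ))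
    rw [StarSubalgebra.coe_centralizer_centralizer, Set.centralizer_centralizer_centralizer]

/-- `L_μ(Γ)` as a `*`-algebra. -/
abbrev Cocycle.Alg (μ : Cocycle Γ) : Type _ := μ.vN.toStarSubalgebra

theorem Cocycle.translation_mem (μ : Cocycle Γ) (γ : Γ) :
    (μ.translation γ : L2 Γ →L[ℂ] L2 Γ) ∈ μ.vN.toStarSubalgebra := by
  refine (StarSubalgebra.mem_centralizer_iff ℂ).2 fun y hy => ?_
  have h1 := (StarSubalgebra.mem_centralizer_iff ℂ).1 hy _ ⟨γ, rfl⟩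
  have h2 := (StarSubalgebra.mem_centralizer_iff ℂ).1 (star_mem hy) _ ⟨γ, rfl⟩
  exact ⟨h1.1.symm, h2.1.symm⟩

/-- The canonical unitary `u(γ)` as an element of `L_μ(Γ)`. -/
def Cocycle.u (μ : Cocycle Γ) (γ : Γ) : μ.Alg := ⟨μ.translation γ, μ.translation_mem γ⟩

/-- A `*`-automorphism of `B(ℓ²(Γ))` which maps the generators to multiples of generators maps
`L_μ(Γ)` into itself. -/
theorem Cocycle.map_mem (μ : Cocycle Γ) (Φ : (L2 Γ →L[ℂ] L2 Γ) ≃⋆ₐ[ℂ] (L2 Γ →L[ℂ] L2 Γ))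
    (hΦ : ∀ γ, ∃ (c : ℂ) (γ' : Γ), Φ (μ.translation γ : L2 Γ →L[ℂ] L2 Γ)
      = c • (μ.translation γ' : L2 Γ →L[ℂ] L2 Γ))
    {x : L2 Γ →L[ℂ] L2 Γ} (hx : x ∈ μ.vN.toStarSubalgebra) : Φ x ∈ μ.vN.toStarSubalgebra := by
  have key : ∀ y ∈ StarSubalgebra.centralizer ℂ μ.translations,
      Φ.symm y ∈ StarSubalgebra.centralizer ℂ μ.translations := by
    intro y hy
    refine (StarSubalgebra.mem_centralizer_iff ℂ).2 ?_
    rintro _ ⟨γ, rfl⟩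
    obtain ⟨c, γ', h⟩ := hΦ γ
    have h' := (StarSubalgebra.mem_centralizer_iff ℂ).1 hy _ ⟨γ', rfl⟩
    constructor
    · refine (EquivLike.injective Φ) ?_
      dsimp only at h' ⊢
      rw [map_mul, map_mul, h, StarAlgEquiv.apply_symm_apply, smul_mul_assoc, h'.1, mul_smul_comm]
    · refine (EquivLike.injective Φ) ?_
      dsimp only at h' ⊢
      rw [map_mul, map_mul, map_star, h, StarAlgEquiv.apply_symm_apply, star_smul, smul_mul_assoc,
        h'.2, mul_smul_comm]
  have hx' := (StarSubalgebra.mem_centralizer_iff ℂ).1 hx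
  refine (StarSubalgebra.mem_centralizer_iff ℂ).2 fun y hy => ?_
  have comm : ∀ y ∈ StarSubalgebra.centralizer ℂ μ.translations, y * Φ x = Φ x * y := by
    intro y hy
    have := congrArg Φ (hx' _ (key y hy)).1
    simpa only [map_mul, StarAlgEquiv.apply_symm_apply] using this
  exact ⟨comm y hy, comm _ (star_mem hy)⟩

/-- The restriction to `L_μ(Γ)` of a `*`-automorphism of `B(ℓ²(Γ))` which preserves `L_μ(Γ)`. -/
def Cocycle.restrict (μ : Cocycle Γ) (Φ : (L2 Γ →L[ℂ] L2 Γ) ≃⋆ₐ[ℂ] (L2 Γ →L[ℂ] L2 Γ))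
    (h : ∀ x ∈ μ.vN.toStarSubalgebra, Φ x ∈ μ.vN.toStarSubalgebra)
    (h' : ∀ x ∈ μ.vN.toStarSubalgebra, Φ.symm x ∈ μ.vN.toStarSubalgebra) : μ.Alg ≃⋆ₐ[ℂ] μ.Alg where
  toFun x := ⟨Φ x.1, h x.1 x.2⟩
  invFun x := ⟨Φ.symm x.1, h' x.1 x.2⟩
  left_inv x := Subtype.ext (Φ.symm_apply_apply x.1)
  right_inv x := Subtype.ext (Φ.apply_symm_apply x.1)
  map_mul' x y := Subtype.ext (map_mul Φ x.1 y.1)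
  map_add' x y := Subtype.ext (map_add Φ x.1 y.1)
  map_star' x := Subtype.ext (map_star Φ x.1)
  map_smul' c x := Subtype.ext (map_smul Φ c x.1)

theorem Cocycle.coe_restrict (μ : Cocycle Γ) (Φ : (L2 Γ →L[ℂ] L2 Γ) ≃⋆ₐ[ℂ] (L2 Γ →L[ℂ] L2 Γ))
    (h : ∀ x ∈ μ.vN.toStarSubalgebra, Φ x ∈ μ.vN.toStarSubalgebra)
    (h' : ∀ x ∈ μ.vN.toStarSubalgebra, Φ.symm x ∈ μ.vN.toStarSubalgebra) (x : μ.Alg) :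
    (μ.restrict Φ h h' x).1 = Φ x.1 := rfl

/-- The action `x ↦ W_g x W_g^*` on `L_μ(Γ)` given by a unitary representation `W` which normalizes
`L_μ(Γ)`. -/
def Cocycle.adAction (μ : Cocycle Γ) {K : Type*} [Group K] (W : K →* unitary (L2 Γ →L[ℂ] L2 Γ))
    (hW : ∀ g, ∀ x ∈ μ.vN.toStarSubalgebra,
      Unitary.conjStarAlgAut ℂ _ (W g) x ∈ μ.vN.toStarSubalgebra) :
    K →* (μ.Alg ≃⋆ₐ[ℂ] μ.Alg) where
  toFun g := μ.restrict (Unitary.conjStarAlgAut ℂ _ (W g)) (hW g) (fun x hx => by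
    have h := hW g⁻¹ x hx
    rwa [map_inv, map_inv] at h)
  map_one' := by
    refine StarAlgEquiv.ext fun x => Subtype.ext ?_
    rw [Cocycle.coe_restrict, map_one, map_one]
    rfl
  map_mul' g₁ g₂ := by
    refine StarAlgEquiv.ext fun x => Subtype.ext ?_
    refine Eq.trans ?_ (Unitary.conjStarAlgAut_mul_apply (S := ℂ) (W g₁) (W g₂) x.1)
    rw [Cocycle.coe_restrict, map_mul]

theorem Cocycle.coe_adAction (μ : Cocycle Γ) {K : Type*} [Group K]
    (W : K →* unitary (L2 Γ →L[ℂ] L2 Γ))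
    (hW : ∀ g, ∀ x ∈ μ.vN.toStarSubalgebra,
      Unitary.conjStarAlgAut ℂ _ (W g) x ∈ μ.vN.toStarSubalgebra) (g : K) (x : μ.Alg) :
    (μ.adAction W hW g x).1 = Unitary.conjStarAlgAut ℂ _ (W g) x.1 := rfl

end TwistedVN

/-! ### The group `ℤ² ⋊ SL(2, ℤ)` and its action on finitely supported functions -/

/-- `ℤ²`. -/
abbrev Z2 : Type := Fin 2 → ℤ

/-- The function `det((q, r), (q₀, r₀)) = q r₀ - r q₀`. -/
def det (k l : Z2) : ℤ := k 0 * l 1 - k 1 * l 0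

/-- `SL(2, ℤ)` acting on (the multiplicative copy of) `ℤ²` by matrix multiplication. -/
def slAut : SL(2, ℤ) →* MulAut (Multiplicative Z2) where
  toFun γ := AddEquiv.toMultiplicative (DistribMulAction.toAddEquiv Z2 γ)
  map_one' := by
    ext v : 1
    exact congrArg Multiplicative.ofAdd (one_smul SL(2, ℤ) v.toAdd)
  map_mul' γ₁ γ₂ := by
    ext v : 1
    exact congrArg Multiplicative.ofAdd (mul_smul γ₁ γ₂ v.toAdd)

/-- The group `ℤ² ⋊ SL(2, ℤ)`. -/
abbrev G : Type := Multiplicative Z2 ⋊[slAut] SL(2, ℤ)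

/-- The affine action `(k, γ) · v = k + γ v` of `ℤ² ⋊ SL(2, ℤ)` on `ℤ²`. -/
def affine : G →* Equiv.Perm Z2 where
  toFun g :=
    { toFun := fun v => g.left.toAdd + (g.right : Matrix (Fin 2) (Fin 2) ℤ) *ᵥ v
      invFun := fun v => g.right⁻¹ • (v - g.left.toAdd)
      left_inv := fun v => by
        change g.right⁻¹ • (g.left.toAdd + g.right • v - g.left.toAdd) = v
        rw [add_sub_cancel_left, inv_smul_smul]
      right_inv := fun v => by
        change g.left.toAdd + g.right • g.right⁻¹ • (v - g.left.toAdd) = v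
        rw [smul_inv_smul, add_sub_cancel] }
  map_one' := by
    ext1 v
    change (0 : Z2) + (1 : SL(2, ℤ)) • v = v
    rw [one_smul, zero_add]
  map_mul' g₁ g₂ := by
    ext1 v
    change (g₁.left.toAdd + g₁.right • g₂.left.toAdd) + (g₁.right * g₂.right) • v =
      g₁.left.toAdd + g₁.right • (g₂.left.toAdd + g₂.right • v)
    rw [mul_smul, smul_add, add_assoc]

theorem affine_apply (g : G) (v : Z2) : affine g v = g.left.toAdd + g.right • v := rfl

section Lambda

variable (H : Type*) [AddCommGroup H]

/-- The group `Λ(H)` of finitely supported functions `ℤ² → H` with sum zero. -/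
def Lambda : AddSubgroup (Z2 →₀ H) :=
  (Finsupp.liftAddHom (fun _ : Z2 => AddMonoidHom.id H)).ker

variable {H}

theorem mem_Lambda {f : Z2 →₀ H} : f ∈ Lambda H ↔ (f.sum fun _ h => h) = 0 := Iff.rfl

/-- The action `(g · λ)(k) = λ(g⁻¹ · k)` of `ℤ² ⋊ SL(2, ℤ)` on `Λ(H)`. -/
def shift (g : G) : Lambda H ≃+ Lambda H where
  toFun l := ⟨Finsupp.equivMapDomain (affine g) l.1, by
    rw [mem_Lambda, Finsupp.sum_equivMapDomain]
    exact l.2⟩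
  invFun l := ⟨Finsupp.equivMapDomain (affine g).symm l.1, by
    rw [mem_Lambda, Finsupp.sum_equivMapDomain]
    exact l.2⟩
  left_inv l := by
    ext k
    simp [Finsupp.equivMapDomain_apply]
  right_inv l := by
    ext k
    simp [Finsupp.equivMapDomain_apply]
  map_add' l₁ l₂ := by
    ext k
    simp [Finsupp.equivMapDomain_apply]

theorem shift_apply (g : G) (l : Lambda H) (k : Z2) :
    (shift g l).1 k = l.1 (affine g⁻¹ k) := by
  rw [map_inv]
  rfl

theorem shift_one : (shift 1 : Lambda H ≃+ Lambda H) = AddEquiv.refl _ := by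
  ext l k
  rw [shift_apply, inv_one, map_one]
  rfl

theorem shift_mul (g₁ g₂ : G) (l : Lambda H) : shift (g₁ * g₂) l = shift g₁ (shift g₂ l) := by
  ext k
  rw [shift_apply, shift_apply, shift_apply, mul_inv_rev, map_mul]
  rfl

theorem shift_apply_affine (g : G) (l : Lambda H) (k : Z2) :
    (shift g l).1 (affine g k) = l.1 k := by
  change l.1 ((affine g).symm (affine g k)) = l.1 k
  rw [Equiv.symm_apply_apply]

/-- The map `Λ(H) → Λ(K)`, `λ ↦ φ ∘ λ`, induced by a group homomorphism `φ`. -/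
def Lambda.map {K : Type*} [AddCommGroup K] (φ : H →+ K) : Lambda H →+ Lambda K where
  toFun l := ⟨Finsupp.mapRange φ (map_zero φ) l.1, by
    rw [mem_Lambda, Finsupp.sum_mapRange_index (fun _ => rfl)]
    have := congrArg φ (mem_Lambda.1 l.2)
    rwa [map_finsuppSum, map_zero] at this⟩
  map_zero' := by
    ext k
    simp
  map_add' l₁ l₂ := by
    ext k
    simp

/-- The `2`-cocycle `μ̃(λ₁, λ₂) = ∏_k μ(λ₁(k), λ₂(k))`, restricted to `Λ(H)`. Only finitely many
factors differ from `1`. -/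
def Cocycle.tilde (μ : Cocycle H) : Cocycle (Lambda H) where
  toFun l₁ l₂ := ∏ᶠ k : Z2, μ (l₁.1 k) (l₂.1 k)
  cocycle' l₁ l₂ l₃ := by
    have fin : ∀ a b : Lambda H, (Function.mulSupport fun k => μ (a.1 k) (b.1 k)).Finite := by
      intro a b
      refine a.1.hasFiniteSupport.subset fun k hk ha => hk ?_
      have ha' : a.1 k = 0 := ha
      simp [ha', μ.zero_left']
    rw [← finprod_mul_distrib (fin _ _) (fin _ _), ← finprod_mul_distrib (fin _ _) (fin _ _)]
    exact finprod_congr fun k => μ.cocycle' _ _ _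
  zero_left' l := by simp [μ.zero_left']
  zero_right' l := by simp [μ.zero_right']

theorem Cocycle.tilde_shift (μ : Cocycle H) (g : G) (l₁ l₂ : Lambda H) :
    μ.tilde (shift g l₁) (shift g l₂) = μ.tilde l₁ l₂ := by
  change (∏ᶠ k : Z2, μ ((shift g l₁).1 k) ((shift g l₂).1 k)) = ∏ᶠ k : Z2, μ (l₁.1 k) (l₂.1 k)
  rw [← finprod_comp_equiv (affine g)]
  simp only [shift_apply_affine]

/-! ### The twisted Bernoulli shift action -/

/-- The finite von Neumann algebra `N(H, μ) = L_μ̃(Λ(H))`, as a `*`-algebra. -/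
abbrev N (μ : Cocycle H) : Type _ := μ.tilde.Alg

/-- The scalar `∏_m χ(λ(m)) ^ det(k, m)`. Only finitely many factors differ from `1`. -/
def twist (χ : AddChar H Circle) (k : Z2) (l : Lambda H) : Circle :=
  ∏ᶠ m : Z2, χ (l.1 m) ^ det k m

theorem twist_finite (χ : AddChar H Circle) (f : Z2 → ℤ) (l : Lambda H) :
    (Function.mulSupport fun m => χ (l.1 m) ^ f m).Finite := by
  refine l.1.hasFiniteSupport.subset fun k hk ha => hk ?_
  have ha' : l.1 k = 0 := ha
  simp [ha']

theorem twist_add (χ : AddChar H Circle) (k : Z2) (l₁ l₂ : Lambda H) :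
    twist χ k (l₁ + l₂) = twist χ k l₁ * twist χ k l₂ := by
  rw [twist, twist, twist, ← finprod_mul_distrib (twist_finite χ _ _) (twist_finite χ _ _)]
  exact finprod_congr fun m => by simp [AddChar.map_add_eq_mul, mul_zpow]

theorem prod_char (χ : AddChar H Circle) (l : Lambda H) (n : ℤ) :
    (∏ᶠ m : Z2, χ (l.1 m) ^ n) = 1 := by
  rw [finprod_eq_prod_of_mulSupport_subset (s := l.1.support)]
  · have h0 : ∑ m ∈ l.1.support, l.1 m = 0 := mem_Lambda.1 l.2
    have h1 : ∏ m ∈ l.1.support, χ (l.1 m) = χ (∑ m ∈ l.1.support, l.1 m) :=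
      (map_prod χ.toMonoidHom (fun m => Multiplicative.ofAdd (l.1 m)) l.1.support).symm
    rw [Finset.prod_zpow, h1, h0, AddChar.map_zero_eq_one, one_zpow]
  · intro k hk
    by_contra h
    rw [Finset.mem_coe, Finsupp.notMem_support_iff] at h
    exact hk (by simp [h])

theorem det_add_left (k l m : Z2) : det (k + l) m = det k m + det l m := by
  simp only [det, Pi.add_apply]
  ring

theorem det_add_right (k l m : Z2) : det k (l + m) = det k l + det k m := by
  simp only [det, Pi.add_apply]
  ring

theorem det_smul (γ : SL(2, ℤ)) (k l : Z2) : det (γ • k) (γ • l) = det k l := by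
  have h := γ.det_coe
  rw [Matrix.det_fin_two] at h
  simp only [det, Matrix.SpecialLinearGroup.smul_def, Matrix.smul_eq_mulVec, Matrix.mulVec,
    dotProduct, Fin.sum_univ_two]
  linear_combination (k 0 * l 1 - k 1 * l 0) * h

/-- The scalar in `β(k, γ) u(λ) = phase · u((k, γ) · λ)`: since `β(k, γ) = ρ(k) ∘ ρ(γ)` with
`ρ(γ) u(λ) = u(γ · λ)`, it is `∏_m χ((γ · λ)(m)) ^ det(k, m)`. -/
def phase (χ : AddChar H Circle) (g : G) (l : Lambda H) : Circle :=
  twist χ g.left.toAdd (shift (SemidirectProduct.inr g.right) l)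

theorem phase_eq (χ : AddChar H Circle) (g : G) (l : Lambda H) :
    phase χ g l = ∏ᶠ m : Z2, χ (l.1 m) ^ det g.left.toAdd (g.right • m) := by
  rw [phase, twist, ← finprod_comp_equiv (affine (SemidirectProduct.inr g.right))]
  simp only [shift_apply_affine]
  refine finprod_congr fun m => ?_
  rw [affine_apply]
  simp

theorem phase_one (χ : AddChar H Circle) (l : Lambda H) : phase χ 1 l = 1 := by
  rw [phase_eq]
  simp [det]

theorem phase_mul (χ : AddChar H Circle) (g₁ g₂ : G) (l : Lambda H) :
    phase χ (g₁ * g₂) l = phase χ g₁ (shift g₂ l) * phase χ g₂ l := by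
  have e1 : phase χ g₁ (shift g₂ l) =
      ∏ᶠ m : Z2, χ (l.1 m) ^ det g₁.left.toAdd (g₁.right • affine g₂ m) := by
    rw [phase_eq, ← finprod_comp_equiv (affine g₂)]
    simp only [shift_apply_affine]
  have e2 := prod_char χ l (det g₁.left.toAdd (g₁.right • g₂.left.toAdd))
  rw [e1, phase_eq, phase_eq, ← finprod_mul_distrib (twist_finite χ _ _) (twist_finite χ _ _),
    ← mul_one (∏ᶠ m : Z2, χ (l.1 m) ^ det (g₁ * g₂).left.toAdd ((g₁ * g₂).right • m)), ← e2,
    ← finprod_mul_distrib (twist_finite χ _ _) (twist_finite χ _ _)]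
  refine finprod_congr fun m => ?_
  rw [← zpow_add, ← zpow_add]
  congr 1
  have hl : (g₁ * g₂).left.toAdd = g₁.left.toAdd + g₁.right • g₂.left.toAdd := rfl
  rw [hl, SemidirectProduct.mul_right, affine_apply, mul_smul, smul_add, det_add_left,
    det_add_right, det_smul]
  ring

theorem phase_add (χ : AddChar H Circle) (g : G) (l₁ l₂ : Lambda H) :
    phase χ g (l₁ + l₂) = phase χ g l₁ * phase χ g l₂ := by
  rw [phase, map_add, twist_add]
  rfl

/-- The unitary representation `δ_λ ↦ phase(g, λ) δ_{g · λ}` of `ℤ² ⋊ SL(2, ℤ)` on `ℓ²(Λ(H))`, which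
implements the twisted Bernoulli shift. -/
def implement (χ : AddChar H Circle) : G →* unitary (L2 (Lambda H) →L[ℂ] L2 (Lambda H)) where
  toFun g := monomial (shift g).toEquiv (phase χ g)
  map_one' := by
    rw [shift_one, ← monomial_one]
    exact congrArg _ (funext fun l => phase_one χ l)
  map_mul' g₁ g₂ := by
    rw [monomial_mul]
    refine congrArg₂ _ (Equiv.ext fun l => shift_mul g₁ g₂ l) (funext fun l => phase_mul χ g₁ g₂ l)

theorem implement_mul_translation (μ : Cocycle H) (χ : AddChar H Circle) (g : G) (l : Lambda H) :
    (implement χ g : L2 (Lambda H) →L[ℂ] L2 (Lambda H)) * μ.tilde.translation l =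
      (phase χ g l : ℂ) • ((μ.tilde.translation (shift g l) : L2 (Lambda H) →L[ℂ] L2 (Lambda H)) *
        implement χ g) := by
  refine ContinuousLinearMap.ext fun f => lp.ext (funext fun x => ?_)
  obtain ⟨y, rfl⟩ := (shift g).surjective x
  have h1 : shift g y = shift g l + shift g (-l + y) := by simp
  have h2 : phase χ g y = phase χ g l * phase χ g (-l + y) := by rw [← phase_add]; simp
  have h3 : -shift g l + shift g y = shift g (-l + y) := by simp
  have e1 : ((shift g).toEquiv).symm (shift g y) = y := (shift g).symm_apply_apply y
  have e3 : ((shift g).toEquiv).symm (shift g (-l + y)) = -l + y := (shift g).symm_apply_apply _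
  have e2 : (Equiv.addLeft (shift g l)).symm (shift g y) = shift g (-l + y) := h3
  have e4 : (Equiv.addLeft l).symm y = -l + y := rfl
  change (monomial (shift g).toEquiv (phase χ g)).1
      ((monomial (Equiv.addLeft l) (μ.tilde l)).1 f) (shift g y) =
    (phase χ g l : ℂ) * (monomial (Equiv.addLeft (shift g l)) (μ.tilde (shift g l))).1
      ((monomial (shift g).toEquiv (phase χ g)).1 f) (shift g y)
  rw [monomial_apply, monomial_apply, monomial_apply, monomial_apply, e1, e2, e3, e4,
    μ.tilde_shift, h2, Circle.coe_mul]
  ring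

theorem conj_translation (μ : Cocycle H) (χ : AddChar H Circle) (g : G) (l : Lambda H) :
    Unitary.conjStarAlgAut ℂ _ (implement χ g)
        (μ.tilde.translation l : L2 (Lambda H) →L[ℂ] L2 (Lambda H)) =
      (phase χ g l : ℂ) •
        (μ.tilde.translation (shift g l) : L2 (Lambda H) →L[ℂ] L2 (Lambda H)) := by
  rw [Unitary.conjStarAlgAut_apply, implement_mul_translation, smul_mul_assoc, mul_assoc,
    Unitary.mul_star_self_of_mem (implement χ g).2, mul_one]

theorem conj_mem (μ : Cocycle H) (χ : AddChar H Circle) (g : G)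
    {x : L2 (Lambda H) →L[ℂ] L2 (Lambda H)} (hx : x ∈ μ.tilde.vN.toStarSubalgebra) :
    Unitary.conjStarAlgAut ℂ _ (implement χ g) x ∈ μ.tilde.vN.toStarSubalgebra :=
  μ.tilde.map_mem _ (fun l => ⟨_, _, conj_translation μ χ g l⟩) hx

/-- The twisted Bernoulli shift action `β(H, μ, χ)` of `ℤ² ⋊ SL(2, ℤ)` on `N(H, μ)`: the
automorphism `β(g)` is `x ↦ W_g x W_g^*`, where `W` is the implementing representation. -/
def beta (μ : Cocycle H) (χ : AddChar H Circle) : G →* (N μ ≃⋆ₐ[ℂ] N μ) :=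
  μ.tilde.adAction (implement χ) (fun g _ hx => conj_mem μ χ g hx)

/-- The defining formula `β(k, γ)(u(λ)) = (∏_m χ((γ · λ)(m)) ^ det(k, m)) u((k, γ) · λ)`. -/
theorem beta_u (μ : Cocycle H) (χ : AddChar H Circle) (g : G) (l : Lambda H) :
    beta μ χ g (μ.tilde.u l) = (phase χ g l : ℂ) • μ.tilde.u (shift g l) :=
  Subtype.ext (conj_translation μ χ g l)

end Lambda

/-- The `*`-isomorphism `π` gives conjugacy between `β(H_a, μ_a, χ_a)` and `β(H_b, μ_b, χ_b)`. -/
def IsConjugacy {A B : Type*} [AddCommGroup A] [AddCommGroup B]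
    (μA : Cocycle A) (χA : AddChar A Circle) (μB : Cocycle B) (χB : AddChar B Circle)
    (π : N μA ≃⋆ₐ[ℂ] N μB) : Prop :=
  ∀ (g : G) (x : N μA), π (beta μA χA g x) = beta μB χB g (π x)

/-- `π(u(λ)) = v(φ ∘ λ)` modulo `𝕋`, for all `λ ∈ Λ(H_a)`. -/
def InducedBy {A B : Type*} [AddCommGroup A] [AddCommGroup B]
    (μA : Cocycle A) (μB : Cocycle B) (π : N μA ≃⋆ₐ[ℂ] N μB) (φ : A ≃+ B) : Prop :=
  ∀ l : Lambda A, ∃ c : Circle,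
    π (μA.tilde.u l) = (c : ℂ) • μB.tilde.u (Lambda.map φ.toAddMonoidHom l)

end TwistedBernoulli

end

/-!
An element `x` of `L_μ(Γ)` is determined by its Fourier coefficients `x δ_0 ∈ ℓ²(Γ)`: the
twisted right translations commute with `L_μ(Γ)` and move `δ_0` to all the `δ_γ`
(`coeff_injective`). Products are twisted convolutions (`hasSum_coeff_mul`), and a unitary with a
single coefficient is a multiple of a canonical unitary (`exists_eq_smul_u`).

*A conjugacy is induced by an isomorphism.* Let `π` be a conjugacy. If `g` is a shear which fixes a
line of `ℤ²` pointwise and `x` is an eigenvector of `β(g)`, then the absolute values of the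
coefficients of `x` are constant along `g`-orbits and square summable, so that `x` is supported on
elements of `Λ(H)` supported on the line (`apply_eq_zero_of_shear`). Writing `pair x y h` for `h` at
`x`, `-h` at `y`, this applies to the images under `π` of the canonical unitaries of
`pair e₁ 0 h`, `pair 0 e₂ h` and `pair e₁ e₂ h`, the sides of a triangle. The third element is the
sum of the first two, and elements with sum zero supported on two of the lines are determined by
their sum. Comparing supports leaves one coefficient, at `pair e₁ 0 h'`
(`eq_pair_of_coeff_ne_zero`), and `φ(h) = h'`. As the orbit of the elements `pair e₁ 0 h` generates
`Λ(H)` (`Lambda.mem_of_pair_mem`), `π(u(λ))` is a multiple of `v(φ ∘ λ)` for all `λ`. The same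
applies to `π⁻¹`, so `φ` is bijective (`IsConjugacy.exists_inducedBy`). Neither normality of `π` nor
preservation of the trace enters.

*The invariants.* Let `π(u(λ)) = c(λ) v(φ ∘ λ)`. Multiplicativity makes the quotient of `μ̃_a` and
`μ̃_b ∘ φ` the coboundary of `c`, hence symmetric. Evaluated at elements supported on two pairs of
points with one point in common, it is the quotient of `μ_a` and `μ_b ∘ φ`, which is therefore
symmetric as well; symmetric cocycles are coboundaries because the circle is divisible
(`InducedBy.cohomologous`). Equivariance determines how `c` varies along orbits. The pairs
`pair e₁ e₂ h` and `pair e₂ e₁ h` are related by a half turn, with scalars `χ²`, and through their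
decompositions at the vertex `0` also by a quarter turn, without scalars (`IsConjugacy.sq_eq`).

*Construction of a conjugacy.* Let `b` trivialize `μ_a / (μ_b ∘ φ)`, and let `θ = χ_a / (χ_b ∘ φ)`,
which has values `±1`. The quadratic form `q(m) = m₀² + m₀ m₁ + m₁²` satisfies
`q(k + γ m) = q(m) + q(k) + det(k, γ m)` modulo `2`. Hence for
`c(λ) = ∏_m b(λ(m)) θ(λ(m))^{q(m)}` the unitary `δ_λ ↦ c(λ) δ_{φ ∘ λ}` conjugates the two actions
(`exists_isConjugacy`).
-/

open scoped Matrix MatrixGroups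

noncomputable section

namespace TwistedBernoulli

/-! ### Symmetric cocycles are coboundaries -/

section Extension

variable {Γ : Type*} [AddCommGroup Γ]

/-- The central extension `0 → 𝕋 → E → Γ → 0` defined by a `2`-cocycle `ν`, realized on the set
`Γ × 𝕋` with `(g, s) + (h, t) = (g + h, s t ν(g, h))`. -/
@[ext]
structure Cocycle.Extension (ν : Cocycle Γ) where
  base : Γ
  fiber : Circle

/-- The extension by a symmetric cocycle is an abelian group. This is a definition and not an
instance because of the symmetry hypothesis. -/
@[reducible]
def Cocycle.Extension.addCommGroup (ν : Cocycle Γ) (hν : ∀ g h, ν g h = ν h g) :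
    AddCommGroup ν.Extension where
  add x y := ⟨x.base + y.base, x.fiber * y.fiber * ν x.base y.base⟩
  zero := ⟨0, 1⟩
  neg x := ⟨-x.base, x.fiber⁻¹ * (ν (-x.base) x.base)⁻¹⟩
  nsmul := @nsmulRec _ ⟨⟨0, 1⟩⟩ ⟨fun x y => ⟨x.base + y.base, x.fiber * y.fiber * ν x.base y.base⟩⟩
  zsmul := @zsmulRec _ ⟨⟨0, 1⟩⟩ ⟨fun x y => ⟨x.base + y.base, x.fiber * y.fiber * ν x.base y.base⟩⟩
    ⟨fun x => ⟨-x.base, x.fiber⁻¹ * (ν (-x.base) x.base)⁻¹⟩⟩ (@nsmulRec _ ⟨⟨0, 1⟩⟩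
      ⟨fun x y => ⟨x.base + y.base, x.fiber * y.fiber * ν x.base y.base⟩⟩)
  add_assoc x y z := by
    refine Extension.ext (add_assoc _ _ _) ?_
    change x.fiber * y.fiber * ν x.base y.base * z.fiber * ν (x.base + y.base) z.base =
      x.fiber * (y.fiber * z.fiber * ν y.base z.base) * ν x.base (y.base + z.base)
    calc _ = x.fiber * y.fiber * z.fiber * (ν x.base y.base * ν (x.base + y.base) z.base) := by
          ac_rfl
      _ = _ := by rw [ν.cocycle']; ac_rfl
  zero_add x := Extension.ext (zero_add _) (by
    change 1 * x.fiber * ν 0 x.base = x.fiber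
    rw [ν.zero_left', one_mul, mul_one])
  add_zero x := Extension.ext (add_zero _) (by
    change x.fiber * 1 * ν x.base 0 = x.fiber
    rw [ν.zero_right', mul_one, mul_one])
  neg_add_cancel x := Extension.ext (neg_add_cancel _) (by
    change x.fiber⁻¹ * (ν (-x.base) x.base)⁻¹ * x.fiber * ν (-x.base) x.base = 1
    rw [mul_right_comm _ _ x.fiber, inv_mul_cancel, one_mul, inv_mul_cancel])
  add_comm x y := Extension.ext (add_comm _ _) (by
    change x.fiber * y.fiber * ν x.base y.base = y.fiber * x.fiber * ν y.base x.base
    rw [hν, mul_comm x.fiber])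

/-- The circle group is divisible. -/
theorem circle_exists_zpow_eq {n : ℤ} (hn : n ≠ 0) (z : Circle) : ∃ w : Circle, w ^ n = z := by
  refine ⟨Circle.exp (Complex.arg z / n), ?_⟩
  have hn' : (n : ℝ) ≠ 0 := Int.cast_ne_zero.2 hn
  rw [← Circle.exp_intCast_mul, mul_div_cancel₀ _ hn', Circle.exp_arg]

open Classical in
/-- A symmetric cocycle with values in `𝕋` is a coboundary: the extension it defines is abelian, and
it splits because `𝕋` is divisible. -/
theorem Cocycle.exists_coboundary (ν : Cocycle Γ) (hν : ∀ g h, ν g h = ν h g) :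
    ∃ b : Γ → Circle, ∀ g h, ν g h = b g * b h * (b (g + h))⁻¹ := by
  let := Cocycle.Extension.addCommGroup ν hν
  let : DivisibleBy (Additive Circle) ℤ :=
    { div := fun z n => if hn : n = 0 then 0
        else Additive.ofMul (circle_exists_zpow_eq hn z.toMul).choose
      div_zero := fun z => dif_pos rfl
      div_cancel := fun {n} z hn => by
        rw [dif_neg hn]
        exact congrArg Additive.ofMul (circle_exists_zpow_eq hn z.toMul).choose_spec }
  let ι : Additive Circle →+ ν.Extension :=
    { toFun := fun z => ⟨0, z.toMul⟩
      map_zero' := rfl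
      map_add' := fun s t => Extension.ext (add_zero 0).symm (by
        change s.toMul * t.toMul = s.toMul * t.toMul * ν 0 0
        rw [ν.zero_left', mul_one]) }
  have hι : Function.Injective ι := fun s t h => congrArg (fun x : ν.Extension => Additive.ofMul x.fiber) h
  obtain ⟨r, hr⟩ := (Module.Baer.of_divisible (Additive Circle)).extension_property_addMonoidHom
    ι hι (AddMonoidHom.id _)
  refine ⟨fun g => (r ⟨g, 1⟩).toMul, fun g h => ?_⟩
  have h1 : (⟨g, 1⟩ + ⟨h, 1⟩ : ν.Extension) = ⟨g + h, 1⟩ + ι (Additive.ofMul (ν g h)) := by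
    refine Extension.ext (add_zero _).symm ?_
    change 1 * 1 * ν g h = 1 * ν g h * ν (g + h) 0
    rw [ν.zero_right', one_mul, mul_one]
  have h2 := congrArg (fun x => (r x).toMul) h1
  have h3 : r (ι (Additive.ofMul (ν g h))) = Additive.ofMul (ν g h) := DFunLike.congr_fun hr _
  simp only [map_add, h3, toMul_add, toMul_ofMul] at h2
  rw [h2, mul_right_comm, mul_inv_cancel, one_mul]

end Extension

/-! ### Fourier coefficients in twisted group von Neumann algebras -/

section Fourier

variable {Γ : Type*} [AddCommGroup Γ] (μ : Cocycle Γ)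

/-- The twisted right translation `δ_g ↦ μ(g, τ) δ_{g + τ}` on `ℓ²(Γ)`. -/
def Cocycle.rightTranslation (τ : Γ) : unitary (L2 Γ →L[ℂ] L2 Γ) :=
  monomial (Equiv.addRight τ) (fun g => μ g τ)

theorem Cocycle.translation_mul_rightTranslation (γ τ : Γ) :
    μ.translation γ * μ.rightTranslation τ = μ.rightTranslation τ * μ.translation γ := by
  rw [translation, rightTranslation, monomial_mul, monomial_mul]
  refine congrArg₂ _ (Equiv.ext fun x => (add_assoc γ x τ).symm) (funext fun x => ?_)
  change μ γ (x + τ) * μ x τ = μ (γ + x) τ * μ γ x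
  rw [mul_comm, ← μ.cocycle', mul_comm]

theorem Cocycle.rightTranslation_mem (τ : Γ) :
    (μ.rightTranslation τ : L2 Γ →L[ℂ] L2 Γ) ∈ StarSubalgebra.centralizer ℂ μ.translations := by
  refine (StarSubalgebra.mem_centralizer_iff ℂ).2 ?_
  rintro _ ⟨γ, rfl⟩
  have h := μ.translation_mul_rightTranslation γ τ
  refine ⟨congrArg Subtype.val h, ?_⟩
  have h' : star (μ.translation γ) * μ.rightTranslation τ =
      μ.rightTranslation τ * star (μ.translation γ) := by
    rw [Unitary.star_eq_inv, inv_mul_eq_iff_eq_mul, ← mul_assoc, h, mul_inv_cancel_right]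
  exact congrArg Subtype.val h'

variable {μ}

theorem Cocycle.rightTranslation_apply (x : μ.Alg) (τ : Γ) (f : L2 Γ) :
    x.1 ((μ.rightTranslation τ).1 f) = (μ.rightTranslation τ).1 (x.1 f) :=
  (DFunLike.congr_fun ((StarSubalgebra.mem_centralizer_iff ℂ).1 x.2 _
    (μ.rightTranslation_mem τ)).1 f).symm

open Classical in
/-- The Fourier coefficients of `x ∈ L_μ(Γ)`: the vector `x δ_0 ∈ ℓ²(Γ)`. -/
def coeff (x : μ.Alg) : L2 Γ := x.1 (lp.single 2 0 1)

theorem coeff_eq [DecidableEq Γ] (x : μ.Alg) : coeff x = x.1 (lp.single 2 0 1) := by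
  rw [coeff]
  congr!

open Classical in
theorem apply_single (x : μ.Alg) (τ ρ : Γ) :
    x.1 (lp.single 2 τ 1) ρ = μ (ρ - τ) τ * coeff x (ρ - τ) := by
  have h : (lp.single 2 τ (1 : ℂ) : L2 Γ) = (μ.rightTranslation τ).1 (lp.single 2 0 1) := by
    rw [Cocycle.rightTranslation, monomial_single]
    simp [μ.zero_left']
  rw [h, Cocycle.rightTranslation_apply, Cocycle.rightTranslation, monomial_apply, coeff,
    Equiv.addRight_symm]
  simp [sub_eq_add_neg]

theorem coeff_injective : Function.Injective (coeff : μ.Alg → L2 Γ) := by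
  classical
  intro x y h
  refine Subtype.ext (ContinuousLinearMap.ext fun f => ?_)
  have hf := lp.hasSum_single (by norm_num) f
  have key : ∀ i, x.1 (lp.single 2 i (f i)) = y.1 (lp.single 2 i (f i)) := fun i => by
    have : (lp.single 2 i (f i) : L2 Γ) = f i • lp.single 2 i 1 := by
      rw [← lp.single_smul, smul_eq_mul, mul_one]
    rw [this, map_smul, map_smul]
    congr 1
    ext ρ
    rw [apply_single, apply_single, h]
  have h1 := x.1.hasSum hf
  simp only [key] at h1
  exact h1.unique (y.1.hasSum hf)

/-- The Fourier coefficients of a product are a twisted convolution. -/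
theorem hasSum_coeff_mul (x y : μ.Alg) (ρ : Γ) :
    HasSum (fun τ => coeff y τ * (μ (ρ - τ) τ * coeff x (ρ - τ))) (coeff (x * y) ρ) := by
  classical
  have h1 := x.1.hasSum (lp.hasSum_single (by norm_num) (coeff y))
  have h2 := (lp.evalCLM ℂ (fun _ : Γ => ℂ) 2 ρ).hasSum h1
  have h3 : (fun τ => coeff y τ * (μ (ρ - τ) τ * coeff x (ρ - τ))) =
      fun τ => lp.evalCLM ℂ (fun _ : Γ => ℂ) 2 ρ (x.1 (lp.single 2 τ (coeff y τ))) := by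
    funext τ
    rw [← apply_single]
    have : (lp.single 2 τ (coeff y τ) : L2 Γ) = coeff y τ • lp.single 2 τ 1 := by
      rw [← lp.single_smul, smul_eq_mul, mul_one]
    rw [this, map_smul, map_smul]
    rfl
  rw [h3]
  exact h2

theorem coeff_smul (c : ℂ) (x : μ.Alg) : coeff (c • x) = c • coeff x := rfl

open Classical in
theorem coeff_u (γ : Γ) : coeff (μ.u γ) = lp.single 2 γ 1 := by
  rw [coeff, Cocycle.u]
  dsimp only
  rw [Cocycle.translation, monomial_single]
  simp [μ.zero_right']

theorem coeff_u_self (γ : Γ) : coeff (μ.u γ) γ = 1 := by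
  classical rw [coeff_u, lp.single_apply_self]

theorem coeff_u_ne {γ σ : Γ} (h : σ ≠ γ) : coeff (μ.u γ) σ = 0 := by
  classical rw [coeff_u, lp.single_apply_ne _ _ _ h]

theorem u_mul_u (γ δ : Γ) : μ.u γ * μ.u δ = (μ γ δ : ℂ) • μ.u (γ + δ) := by
  classical
  refine coeff_injective ?_
  rw [coeff_smul, coeff_u]
  change (μ.translation γ).1 (coeff (μ.u δ)) = _
  rw [coeff_u, Cocycle.translation, monomial_single]
  rfl

theorem u_zero : μ.u 0 = 1 := by
  classical
  refine coeff_injective ?_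
  rw [coeff_u]
  rfl

theorem circle_smul_smul {A : Type*} [AddCommGroup A] [Module ℂ A] (a b : Circle) (x : A) :
    (a : ℂ) • (b : ℂ) • x = ((a * b : Circle) : ℂ) • x := by
  rw [smul_smul, Circle.coe_mul]

theorem eq_inv_mul_smul {A : Type*} [AddCommGroup A] [Module ℂ A] {a b : Circle} {x y : A}
    (h : (a : ℂ) • x = (b : ℂ) • y) : x = ((a⁻¹ * b : Circle) : ℂ) • y := by
  rw [← circle_smul_smul, ← h, circle_smul_smul, inv_mul_cancel, Circle.coe_one, one_smul]

/-- Scalar multiples of canonical unitaries determine the scalar and the group element. -/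
theorem smul_u_inj {a b : Circle} {γ δ : Γ} (h : (a : ℂ) • μ.u γ = (b : ℂ) • μ.u δ) :
    γ = δ ∧ a = b := by
  have h1 := congrArg (fun x => coeff x γ) h
  simp only [coeff_smul, lp.coeFn_smul, Pi.smul_apply, coeff_u_self, smul_eq_mul, mul_one] at h1
  by_cases hγ : γ = δ
  · subst hγ
    rw [coeff_u_self, mul_one] at h1
    exact ⟨rfl, Circle.ext h1⟩
  · rw [coeff_u_ne hγ, mul_zero] at h1
    exact absurd h1 (Circle.coe_ne_zero a)

theorem u_mem_unitary (γ : Γ) : μ.u γ ∈ unitary μ.Alg :=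
  ⟨Subtype.ext (Unitary.star_mul_self_of_mem (μ.translation γ).2),
    Subtype.ext (Unitary.mul_star_self_of_mem (μ.translation γ).2)⟩

theorem norm_coeff_of_mem_unitary {x : μ.Alg} (hx : x ∈ unitary μ.Alg) : ‖coeff x‖ = 1 := by
  classical
  have h : x.1 ∈ unitary (L2 Γ →L[ℂ] L2 Γ) :=
    ⟨congrArg Subtype.val hx.1, congrArg Subtype.val hx.2⟩
  rw [coeff]
  have := Unitary.norm_map (⟨x.1, h⟩ : unitary (L2 Γ →L[ℂ] L2 Γ)) (lp.single 2 0 1)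
  refine this.trans ?_
  rw [lp.norm_single (by norm_num), norm_one]

theorem exists_coeff_ne_zero {x : μ.Alg} (hx : x ∈ unitary μ.Alg) : ∃ σ, coeff x σ ≠ 0 := by
  by_contra! h
  have h1 := norm_coeff_of_mem_unitary hx
  rw [show coeff x = 0 from lp.ext (funext h), norm_zero] at h1
  exact zero_ne_one h1

/-- A unitary with only one Fourier coefficient is a multiple of a canonical unitary. -/
theorem exists_eq_smul_u {x : μ.Alg} (hx : x ∈ unitary μ.Alg) {γ : Γ}
    (h : ∀ σ, coeff x σ ≠ 0 → σ = γ) : ∃ c : Circle, x = (c : ℂ) • μ.u γ := by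
  classical
  have h1 : coeff x = lp.single 2 γ (coeff x γ) := by
    ext σ
    by_cases hσ : σ = γ
    · subst hσ
      rw [lp.single_apply_self]
    · rw [lp.single_apply_ne _ _ _ hσ]
      exact by_contra fun h' => hσ (h σ h')
  have h2 := norm_coeff_of_mem_unitary hx
  rw [h1, lp.norm_single (by norm_num)] at h2
  refine ⟨⟨coeff x γ, mem_sphere_zero_iff_norm.2 h2⟩, coeff_injective ?_⟩
  rw [coeff_smul, coeff_u, ← lp.single_smul, smul_eq_mul, mul_one]
  exact h1

/-- Only finitely many Fourier coefficients are at least as large as a given nonzero one. -/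
theorem finite_norm_coeff_ge (x : μ.Alg) {r : ℝ} (hr : 0 < r) :
    {τ | r ≤ ‖coeff x τ‖}.Finite := by
  have h2 : (0 : ℝ) < (2 : ENNReal).toReal := by norm_num
  have h := ((lp.memℓp (coeff x)).summable h2).tendsto_cofinite_zero.eventually
    (gt_mem_nhds (Real.rpow_pos_of_pos hr (2 : ENNReal).toReal))
  refine (Filter.eventually_cofinite.1 h).subset fun τ hτ => not_lt.2 ?_
  exact Real.rpow_le_rpow hr.le hτ h2.le

end Fourier

/-! ### The elements `h` at `x`, `-h` at `y` of `Λ(H)` -/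

section Pair

variable {H : Type*} [AddCommGroup H]

/-- The element of `Λ(H)` with value `h` at `x` and `-h` at `y`. -/
def pair (x y : Z2) : H →+ Lambda H where
  toFun h := ⟨Finsupp.single x h - Finsupp.single y h, by
    rw [Lambda, AddMonoidHom.mem_ker, map_sub]
    simp⟩
  map_zero' := by
    ext k
    simp
  map_add' h₁ h₂ := by
    ext k
    simp only [Finsupp.single_add, AddSubgroup.coe_add, Finsupp.add_apply, Finsupp.sub_apply]
    abel

theorem pair_apply (x y : Z2) (h : H) (k : Z2) :
    (pair x y h).1 k = Finsupp.single x h k - Finsupp.single y h k := rfl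

theorem pair_apply_left {x y : Z2} (hxy : x ≠ y) (h : H) : (pair x y h).1 x = h := by
  simp [pair_apply, hxy.symm]

theorem pair_apply_right {x y : Z2} (hxy : x ≠ y) (h : H) : (pair x y h).1 y = -h := by
  simp [pair_apply, hxy]

theorem pair_apply_ne {x y k : Z2} (hx : k ≠ x) (hy : k ≠ y) (h : H) : (pair x y h).1 k = 0 := by
  simp [pair_apply, hx, hy]

theorem pair_add_pair (x y z : Z2) (h : H) : pair x y h + pair y z h = pair x z h := by
  ext k
  simp only [AddSubgroup.coe_add, Finsupp.add_apply, pair_apply]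
  abel

theorem pair_neg (x y : Z2) (h : H) : pair x y (-h) = pair y x h := by
  ext k
  rw [map_neg]
  simp only [AddSubgroup.coe_neg, Finsupp.neg_apply, pair_apply]
  abel

theorem shift_pair (g : G) (x y : Z2) (h : H) :
    shift g (pair x y h) = pair (affine g x) (affine g y) h := by
  ext k
  obtain ⟨k, rfl⟩ := (affine g).surjective k
  rw [shift_apply_affine]
  simp [pair_apply, Finsupp.single_apply]

theorem map_pair {K : Type*} [AddCommGroup K] (φ : H →+ K) (x y : Z2) (h : H) :
    Lambda.map φ (pair x y h) = pair x y (φ h) := by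
  ext k
  change φ ((pair x y h).1 k) = _
  rw [pair_apply, pair_apply, map_sub, Finsupp.single_apply, Finsupp.single_apply,
    Finsupp.single_apply, Finsupp.single_apply]
  split_ifs <;> simp

theorem map_shift {K : Type*} [AddCommGroup K] (φ : H →+ K) (g : G) (l : Lambda H) :
    Lambda.map φ (shift g l) = shift g (Lambda.map φ l) := by
  ext k
  rfl

/-- Elements of `Λ(H)` which agree away from one point are equal, as their values have sum zero. -/
theorem Lambda.ext_of_ne (l₁ l₂ : Lambda H) (x : Z2) (h : ∀ k, k ≠ x → l₁.1 k = l₂.1 k) :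
    l₁ = l₂ := by
  have h0 : (l₁ - l₂).1 = Finsupp.single x ((l₁ - l₂).1 x) := by
    ext k
    by_cases hk : k = x
    · subst hk
      simp
    · rw [Finsupp.single_eq_of_ne hk]
      exact sub_eq_zero.2 (h k hk)
  have h1 := mem_Lambda.1 (l₁ - l₂).2
  rw [h0, Finsupp.sum_single_index rfl] at h1
  rw [h1, Finsupp.single_zero] at h0
  exact sub_eq_zero.1 (Subtype.ext h0)

/-- Every element of `Λ(H)` is the sum of the elements `λ(k)` at `k`, `-λ(k)` at `0`. -/
theorem Lambda.eq_sum_pair (l : Lambda H) : l = ∑ k ∈ l.1.support, pair k 0 (l.1 k) := by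
  refine Lambda.ext_of_ne _ _ 0 fun m hm => ?_
  rw [AddSubgroup.val_finsetSum, Finsupp.finsetSum_apply]
  by_cases h : m ∈ l.1.support
  · rw [Finset.sum_eq_single_of_mem m h fun k _ hk => pair_apply_ne hk.symm hm _,
      pair_apply_left hm]
  · rw [Finsupp.notMem_support_iff.1 h, Finset.sum_eq_zero]
    intro k hk
    exact pair_apply_ne (fun e => h (by rwa [e])) hm _

end Pair

/-! ### Generation of `Λ(H)` by one orbit -/

/-- The first basis vector of `ℤ²`. -/
def e₁ : Z2 := ![1, 0]

/-- The second basis vector of `ℤ²`. -/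
def e₂ : Z2 := ![0, 1]

theorem e₁_ne_zero : e₁ ≠ 0 := fun h => by simpa [e₁] using congrFun h 0

theorem e₂_ne_zero : e₂ ≠ 0 := fun h => by simpa [e₂] using congrFun h 1

theorem e₁_ne_e₂ : e₁ ≠ e₂ := fun h => by simpa [e₁, e₂] using congrFun h 0

/-- The rotation `e₁ ↦ e₂`, `e₂ ↦ -e₁`. -/
def rotation : SL(2, ℤ) := ⟨!![0, -1; 1, 0], by simp⟩

theorem sl_smul_apply (γ : SL(2, ℤ)) (m : Z2) (i : Fin 2) :
    (γ • m) i = γ.1 i 0 * m 0 + γ.1 i 1 * m 1 := by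
  simp only [Matrix.SpecialLinearGroup.smul_def, Matrix.smul_eq_mulVec, Matrix.mulVec, dotProduct,
    Fin.sum_univ_two]

theorem rotation_smul_e₁ : rotation • e₁ = e₂ := by
  ext i
  rw [sl_smul_apply]
  fin_cases i <;> simp [rotation, e₁, e₂]

theorem affine_mk (k : Z2) (γ : SL(2, ℤ)) (m : Z2) :
    affine ⟨Multiplicative.ofAdd k, γ⟩ m = k + γ • m := rfl

/-- The orbit of the elements `h` at `e₁`, `-h` at `0` generates `Λ(H)`. -/
theorem Lambda.mem_of_pair_mem {H : Type*} [AddCommGroup H] (S : AddSubmonoid (Lambda H))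
    (hS : ∀ (g : G), ∀ l ∈ S, shift g l ∈ S) (h1 : ∀ h, pair e₁ 0 h ∈ S) (l : Lambda H) :
    l ∈ S := by
  have a1 : ∀ (m : Z2) (h : H), pair (m + e₁) m h ∈ S := fun m h => by
    have := hS ⟨Multiplicative.ofAdd m, 1⟩ _ (h1 h)
    rwa [shift_pair, affine_mk, affine_mk, one_smul, one_smul, add_zero] at this
  have a2 : ∀ (m : Z2) (h : H), pair (m + e₂) m h ∈ S := fun m h => by
    have := hS ⟨Multiplicative.ofAdd m, rotation⟩ _ (h1 h)
    rwa [shift_pair, affine_mk, affine_mk, rotation_smul_e₁, smul_zero, add_zero] at this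
  have walk : ∀ d : Z2, (∀ (m : Z2) (h : H), pair (m + d) m h ∈ S) →
      ∀ (n : ℤ) (m : Z2) (h : H), pair (m + n • d) m h ∈ S := by
    intro d hd n
    induction n using Int.induction_on with
    | zero =>
      intro m h
      have : pair (m + (0 : ℤ) • d) m h = 0 := by
        ext k
        simp [pair_apply]
      rw [this]
      exact S.zero_mem
    | succ n ih =>
      intro m h
      rw [add_smul, one_smul, ← add_assoc, ← pair_add_pair _ (m + (n : ℤ) • d) _ h]
      exact S.add_mem (hd _ h) (ih m h)
    | pred n ih =>
      intro m h
      rw [← pair_add_pair _ (m + (-(n : ℤ)) • d) _ h, ← pair_neg]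
      refine S.add_mem ?_ (ih m h)
      have : m + (-(n : ℤ)) • d = m + (-(n : ℤ) - 1) • d + d := by
        rw [sub_smul, one_smul]
        abel
      rw [this]
      exact hd _ (-h)
  have a3 : ∀ (k : Z2) (h : H), pair k 0 h ∈ S := fun k h => by
    have hk : k = (0 + k 0 • e₁) + k 1 • e₂ := by
      ext i
      fin_cases i <;> simp [e₁, e₂]
    rw [hk, ← pair_add_pair _ (0 + k 0 • e₁) _ h]
    exact S.add_mem (walk e₂ a2 _ _ h) (walk e₁ a1 _ _ h)
  rw [Lambda.eq_sum_pair l]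
  exact S.sum_mem fun k _ => a3 k _

/-! ### Eigenvectors of shears -/

section Shear

variable {H : Type*} [AddCommGroup H] {μ : Cocycle H} {χ : AddChar H Circle}

theorem norm_coeff_beta (g : G) (x : N μ) (σ : Lambda H) :
    ‖coeff (beta μ χ g x) (shift g σ)‖ = ‖coeff x σ‖ := by
  classical
  have h1 : (star (implement χ g).1 : L2 (Lambda H) →L[ℂ] L2 (Lambda H)) (lp.single 2 0 1) =
      lp.single 2 0 1 := by
    have h2 : (implement χ g).1 (lp.single 2 0 1) = lp.single 2 0 1 := by
      change (monomial (shift g).toEquiv (phase χ g)).1 _ = _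
      rw [monomial_single]
      have h3 : phase χ g 0 = 1 := by
        have := phase_add χ g 0 0
        rwa [add_zero, left_eq_mul] at this
      have h4 : (shift g).toEquiv 0 = (0 : Lambda H) := map_zero (shift g)
      rw [h3, h4, Circle.coe_one, one_smul]
    conv_lhs => rw [← h2]
    exact DFunLike.congr_fun (Unitary.star_mul_self_of_mem (implement χ g).2) _
  have h5 : coeff (beta μ χ g x) = (implement χ g).1 (coeff x) := by
    rw [coeff_eq, coeff_eq, beta, Cocycle.coe_adAction, Unitary.conjStarAlgAut_apply]
    exact congrArg (fun f => (implement χ g).1 (x.1 f)) h1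
  rw [h5]
  change ‖(monomial (shift g).toEquiv (phase χ g)).1 (coeff x) ((shift g).toEquiv σ)‖ = _
  rw [monomial_apply, Equiv.symm_apply_apply, norm_mul, Circle.norm_coe, one_mul]

/-- If `x` is an eigenvector of `β(g)`, then the Fourier coefficients of `x` are supported on
functions which vanish at all points with an infinite `g`-orbit: the absolute values of the
coefficients are constant along `g`-orbits and square summable. -/
theorem apply_eq_zero_of_orbit_injective {g : G} {x : N μ} {c : Circle}
    (hx : beta μ χ g x = (c : ℂ) • x) {σ : Lambda H} (hσ : coeff x σ ≠ 0) {m : Z2}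
    (hm : Function.Injective fun n : ℕ => affine (g ^ n) m) : σ.1 m = 0 := by
  by_contra h0
  have step : ∀ τ, ‖coeff x (shift g τ)‖ = ‖coeff x τ‖ := fun τ => by
    have h := norm_coeff_beta (χ := χ) g x τ
    rw [hx, coeff_smul] at h
    rw [← h, lp.coeFn_smul, Pi.smul_apply, norm_smul, Circle.norm_coe, one_mul]
  have iter : ∀ n : ℕ, ‖coeff x (shift (g ^ n) σ)‖ = ‖coeff x σ‖ := fun n => by
    induction n with
    | zero => rw [pow_zero, shift_one]; rfl
    | succ n ih => rw [pow_succ', shift_mul, step, ih]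
  have fin := (finite_norm_coeff_ge x (norm_pos_iff.2 hσ)).biUnion
    (t := fun τ : Lambda H => (τ.1.support : Set Z2)) (fun τ _ => τ.1.support.finite_toSet)
  refine Set.infinite_range_of_injective hm (fin.subset ?_)
  rintro _ ⟨n, rfl⟩
  refine Set.mem_biUnion (x := shift (g ^ n) σ) (iter n).ge ?_
  rw [Finset.mem_coe, Finsupp.mem_support_iff]
  dsimp only
  rwa [shift_apply_affine]

/-- If `g` is a shear `m ↦ m + f(m) d` which fixes the line `f = 0`, then the Fourier coefficients
of an eigenvector of `β(g)` are supported on functions supported on that line. -/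
theorem apply_eq_zero_of_shear {g : G} {f : Z2 → ℤ} {d : Z2} (hd : d ≠ 0)
    (hg : ∀ m, affine g m = m + f m • d) (hf : ∀ m, f (m + f m • d) = f m)
    {x : N μ} {c : Circle} (hx : beta μ χ g x = (c : ℂ) • x) {σ : Lambda H} (hσ : coeff x σ ≠ 0)
    {m : Z2} (hm : f m ≠ 0) : σ.1 m = 0 := by
  refine apply_eq_zero_of_orbit_injective hx hσ (m := m) ?_
  have key : ∀ n : ℕ, affine (g ^ n) m = m + (n * f m) • d ∧ f (affine (g ^ n) m) = f m := by
    intro n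
    induction n with
    | zero => simp
    | succ n ih =>
      have h1 : affine (g ^ (n + 1)) m = affine g (affine (g ^ n) m) := by
        rw [pow_succ', map_mul]
        rfl
      have h2 : affine (g ^ (n + 1)) m = affine (g ^ n) m + f (affine (g ^ n) m) • d := by
        rw [h1, hg]
      refine ⟨?_, by rw [h2, hf, ih.2]⟩
      rw [h2, ih.2, ih.1, add_assoc, ← add_smul]
      push_cast
      ring_nf
  intro n₁ n₂ h
  dsimp only at h
  rw [(key n₁).1, (key n₂).1, add_right_inj] at h
  have := mul_right_cancel₀ hm (smul_left_injective ℤ hd h)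
  exact_mod_cast this

/-- The shear fixing the line through `0` and `e₁`. -/
def shear₁ : G := ⟨1, ⟨!![1, 1; 0, 1], by simp⟩⟩

/-- The shear fixing the line through `0` and `e₂`. -/
def shear₂ : G := ⟨1, ⟨!![1, 0; 1, 1], by simp⟩⟩

/-- The affine shear fixing the line through `e₁` and `e₂`. -/
def shear₃ : G := ⟨Multiplicative.ofAdd ![-1, 1], ⟨!![2, 1; -1, 0], by simp⟩⟩

theorem affine_shear₁ (m : Z2) : affine shear₁ m = m + m 1 • e₁ := by
  rw [affine_apply]
  ext i
  rw [Pi.add_apply, sl_smul_apply]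
  fin_cases i <;> simp [shear₁, e₁]

theorem affine_shear₂ (m : Z2) : affine shear₂ m = m + m 0 • e₂ := by
  rw [affine_apply]
  ext i
  rw [Pi.add_apply, sl_smul_apply]
  fin_cases i <;> simp [shear₂, e₂, add_comm]

theorem affine_shear₃ (m : Z2) : affine shear₃ m = m + (m 0 + m 1 - 1) • (e₁ - e₂) := by
  rw [affine_apply]
  ext i
  rw [Pi.add_apply, sl_smul_apply]
  fin_cases i <;> simp [shear₃, e₁, e₂] <;> ring

variable {x : N μ} {c : Circle} {σ : Lambda H}

theorem apply_eq_zero_of_shear₁ (hx : beta μ χ shear₁ x = (c : ℂ) • x) (hσ : coeff x σ ≠ 0)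
    {m : Z2} (hm : m 1 ≠ 0) : σ.1 m = 0 :=
  apply_eq_zero_of_shear (f := fun m => m 1) e₁_ne_zero affine_shear₁ (by simp [e₁]) hx hσ hm

theorem apply_eq_zero_of_shear₂ (hx : beta μ χ shear₂ x = (c : ℂ) • x) (hσ : coeff x σ ≠ 0)
    {m : Z2} (hm : m 0 ≠ 0) : σ.1 m = 0 :=
  apply_eq_zero_of_shear (f := fun m => m 0) e₂_ne_zero affine_shear₂ (by simp [e₂]) hx hσ hm

theorem apply_eq_zero_of_shear₃ (hx : beta μ χ shear₃ x = (c : ℂ) • x) (hσ : coeff x σ ≠ 0)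
    {m : Z2} (hm : m 0 + m 1 ≠ 1) : σ.1 m = 0 :=
  apply_eq_zero_of_shear (f := fun m => m 0 + m 1 - 1) (sub_ne_zero.2 e₁_ne_e₂) affine_shear₃
    (fun m => by simp [e₁, e₂]; ring) hx hσ (sub_ne_zero.2 hm)

end Shear

/-! ### A conjugacy permutes the canonical unitaries -/

theorem coeff_mul_ne_zero {Γ : Type*} [AddCommGroup Γ] {μ : Cocycle Γ} {x y : μ.Alg} {σ τ : Γ}
    (hσ : coeff x σ ≠ 0) (hτ : coeff y τ ≠ 0)
    (h : ∀ τ', coeff y τ' ≠ 0 → coeff x (σ + τ - τ') ≠ 0 → τ' = τ) :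
    coeff (x * y) (σ + τ) ≠ 0 := by
  have h1 := hasSum_coeff_mul x y (σ + τ)
  have h2 := hasSum_single (f := fun τ' => coeff y τ' *
    (μ (σ + τ - τ') τ' * coeff x (σ + τ - τ'))) τ (fun τ' hne => by
      by_contra h0
      exact hne (h τ' (left_ne_zero_of_mul h0) (right_ne_zero_of_mul (right_ne_zero_of_mul h0))))
  rw [h1.unique h2, add_sub_cancel_right]
  exact mul_ne_zero hτ (mul_ne_zero (Circle.coe_ne_zero _) hσ)

section Conjugacy

variable {A B : Type*} [AddCommGroup A] [AddCommGroup B] {μA : Cocycle A} {χA : AddChar A Circle}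
  {μB : Cocycle B} {χB : AddChar B Circle} {π : N μA ≃⋆ₐ[ℂ] N μB}

theorem IsConjugacy.symm (hπ : IsConjugacy μA χA μB χB π) : IsConjugacy μB χB μA χA π.symm := by
  intro g x
  have h := hπ g (π.symm x)
  have h1 : π (π.symm x) = x := π.apply_symm_apply x
  have h2 := π.symm_apply_apply (beta μA χA g (π.symm x))
  exact (congrArg π.symm (h.trans (congrArg (beta μB χB g) h1))).symm.trans h2

theorem map_u_mem_unitary (π : N μA ≃⋆ₐ[ℂ] N μB) (l : Lambda A) :
    π (μA.tilde.u l) ∈ unitary (N μB) :=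
  Unitary.map_mem π (u_mem_unitary l)

theorem map_smul_u (π : N μA ≃⋆ₐ[ℂ] N μB) (c : Circle) (l : Lambda A) :
    π ((c : ℂ) • μA.tilde.u l) = (c : ℂ) • π (μA.tilde.u l) :=
  map_smul π _ _

theorem map_u_mul_map_u (π : N μA ≃⋆ₐ[ℂ] N μB) (l₁ l₂ : Lambda A) :
    π (μA.tilde.u l₁) * π (μA.tilde.u l₂) =
      (μA.tilde l₁ l₂ : ℂ) • π (μA.tilde.u (l₁ + l₂)) := by
  rw [← map_smul_u, ← u_mul_u]
  exact (map_mul π _ _).symm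

theorem IsConjugacy.beta_map_u (hπ : IsConjugacy μA χA μB χB π) (g : G) (l : Lambda A) :
    beta μB χB g (π (μA.tilde.u l)) = (phase χA g l : ℂ) • π (μA.tilde.u (shift g l)) := by
  rw [← hπ, beta_u, map_smul_u]

theorem IsConjugacy.beta_map_u_of_fixed (hπ : IsConjugacy μA χA μB χB π) {g : G} {l : Lambda A}
    (hl : shift g l = l) :
    beta μB χB g (π (μA.tilde.u l)) = (phase χA g l : ℂ) • π (μA.tilde.u l) :=
  (hπ.beta_map_u g l).trans
    (congrArg (fun l' => (phase χA g l : ℂ) • π (μA.tilde.u l')) hl)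

theorem smul_u_mul_smul_u {Γ : Type*} [AddCommGroup Γ] {μ : Cocycle Γ} (a b : Circle) (γ δ : Γ) :
    (a : ℂ) • μ.u γ * (b : ℂ) • μ.u δ = ((a * b * μ γ δ : Circle) : ℂ) • μ.u (γ + δ) := by
  rw [smul_mul_smul_comm, u_mul_u, smul_smul, Circle.coe_mul, Circle.coe_mul]

/-- If `π` maps `u(l₁)` and `u(l₂)` to multiples of `v(σ₁)` and `v(σ₂)`, then it maps `u(l₁ + l₂)`
to a multiple of `v(σ₁ + σ₂)`. -/
theorem map_u_add {l₁ l₂ : Lambda A} {σ₁ σ₂ : Lambda B} {c₁ c₂ : Circle}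
    (h₁ : π (μA.tilde.u l₁) = (c₁ : ℂ) • μB.tilde.u σ₁)
    (h₂ : π (μA.tilde.u l₂) = (c₂ : ℂ) • μB.tilde.u σ₂) :
    π (μA.tilde.u (l₁ + l₂)) =
      (((μA.tilde l₁ l₂)⁻¹ * (c₁ * c₂ * μB.tilde σ₁ σ₂) : Circle) : ℂ) • μB.tilde.u (σ₁ + σ₂) := by
  have h := map_u_mul_map_u π l₁ l₂
  rw [h₁, h₂, smul_u_mul_smul_u] at h
  exact eq_inv_mul_smul h.symm

/-- If the conjugacy `π` maps `u(l)` to a multiple of `v(σ)`, then it maps `u(g · l)` to a multiple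
of `v(g · σ)`. -/
theorem IsConjugacy.map_u_shift (hπ : IsConjugacy μA χA μB χB π) {l : Lambda A} {σ : Lambda B}
    {c : Circle} (h : π (μA.tilde.u l) = (c : ℂ) • μB.tilde.u σ) (g : G) :
    π (μA.tilde.u (shift g l)) =
      (((phase χA g l)⁻¹ * (c * phase χB g σ) : Circle) : ℂ) • μB.tilde.u (shift g σ) := by
  have h1 := hπ.beta_map_u g l
  have h2 : beta μB χB g ((c : ℂ) • μB.tilde.u σ) = (c : ℂ) • beta μB χB g (μB.tilde.u σ) :=
    map_smul_u (beta μB χB g) c σ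
  rw [h, h2, beta_u, circle_smul_smul] at h1
  exact eq_inv_mul_smul h1.symm

/-- Let `x`, `y`, `z` be eigenvectors of the shears which fix the lines through the edges `e₁, 0`,
`0, e₂` and `e₁, e₂`. If `x y` is a multiple of `z`, then any two Fourier coefficients of `x` and `y`
sit at the elements with values `±h` at the end points of the edges, with the same `h`: they are
supported on the first two lines, and their sum, which determines them, on the third. -/
theorem eq_pair_of_coeff_ne_zero {x y z : N μB} {s c₁ c₂ c₃ : Circle} (hxy : x * y = (s : ℂ) • z)
    (b1 : beta μB χB shear₁ x = (c₁ : ℂ) • x) (b2 : beta μB χB shear₂ y = (c₂ : ℂ) • y)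
    (b3 : beta μB χB shear₃ z = (c₃ : ℂ) • z) {σ τ : Lambda B} (hσ : coeff x σ ≠ 0)
    (hτ : coeff y τ ≠ 0) : σ = pair e₁ 0 (τ.1 0) := by
  have hσ1 : ∀ m : Z2, m 1 ≠ 0 → σ.1 m = 0 := fun m hm => apply_eq_zero_of_shear₁ b1 hσ hm
  have hτ1 : ∀ m : Z2, m 0 ≠ 0 → τ.1 m = 0 := fun m hm => apply_eq_zero_of_shear₂ b2 hτ hm
  have hprod : coeff (x * y) (σ + τ) ≠ 0 := by
    refine coeff_mul_ne_zero hσ hτ fun τ' h1 h2 => Lambda.ext_of_ne _ _ 0 fun m hm => ?_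
    by_cases hm0 : m 0 = 0
    · have hm1 : m 1 ≠ 0 := fun hm1 => hm (by ext i; fin_cases i <;> simp [hm0, hm1])
      have h3 : σ.1 m + τ.1 m - τ'.1 m = 0 := apply_eq_zero_of_shear₁ b1 h2 hm1
      rw [hσ1 m hm1, zero_add] at h3
      exact (sub_eq_zero.1 h3).symm
    · rw [hτ1 m hm0, apply_eq_zero_of_shear₂ b2 h1 hm0]
  have hz : coeff z (σ + τ) ≠ 0 := by
    rw [hxy, coeff_smul] at hprod
    exact right_ne_zero_of_mul hprod
  have hs : ∀ m : Z2, m 0 + m 1 ≠ 1 → σ.1 m + τ.1 m = 0 := fun m hm =>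
    apply_eq_zero_of_shear₃ b3 hz hm
  refine Lambda.ext_of_ne _ _ e₁ fun m hm => ?_
  by_cases hm0 : m = 0
  · subst hm0
    rw [pair_apply_right e₁_ne_zero]
    exact eq_neg_of_add_eq_zero_left (hs 0 (by simp))
  · rw [pair_apply_ne hm hm0]
    by_cases hm1 : m 1 = 0
    · have h0 : m 0 ≠ 0 := fun h0 => hm0 (by ext i; fin_cases i <;> simp [h0, hm1])
      have h1 : m 0 ≠ 1 := fun h1 => hm (by ext i; fin_cases i <;> simp [h1, hm1, e₁])
      have h2 := hs m (by rwa [hm1, add_zero])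
      rwa [hτ1 m h0, add_zero] at h2
    · exact hσ1 m hm1

/-- The image of the canonical unitary at `pair e₁ 0 h` is determined by the relation
`pair e₁ 0 h + pair 0 e₂ h = pair e₁ e₂ h`. -/
theorem IsConjugacy.exists_map_u_pair (hπ : IsConjugacy μA χA μB χB π) (h : A) :
    ∃ (h' : B) (c : Circle), π (μA.tilde.u (pair e₁ 0 h)) = (c : ℂ) • μB.tilde.u (pair e₁ 0 h') := by
  have s1 : shift shear₁ (pair e₁ 0 h) = pair e₁ 0 h := by
    rw [shift_pair, affine_shear₁, affine_shear₁]
    simp [e₁]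
  have s2 : shift shear₂ (pair 0 e₂ h) = pair 0 e₂ h := by
    rw [shift_pair, affine_shear₂, affine_shear₂]
    simp [e₂]
  have s3 : shift shear₃ (pair e₁ e₂ h) = pair e₁ e₂ h := by
    rw [shift_pair, affine_shear₃, affine_shear₃]
    simp [e₁, e₂]
  have b1 := hπ.beta_map_u_of_fixed s1
  have b2 := hπ.beta_map_u_of_fixed s2
  have b3 := hπ.beta_map_u_of_fixed s3
  have hx := map_u_mem_unitary π (pair e₁ 0 h)
  have hy := map_u_mem_unitary π (pair 0 e₂ h)
  have hxy := map_u_mul_map_u π (pair e₁ 0 h) (pair 0 e₂ h)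
  rw [pair_add_pair e₁ 0 e₂ h] at hxy
  obtain ⟨τ, hτ⟩ := exists_coeff_ne_zero hy
  exact ⟨τ.1 0, exists_eq_smul_u hx fun σ hσ => eq_pair_of_coeff_ne_zero hxy b1 b2 b3 hσ hτ⟩

theorem pair_injective {H : Type*} [AddCommGroup H] {x y : Z2} (hxy : x ≠ y) :
    Function.Injective (pair x y : H →+ Lambda H) := fun h₁ h₂ h => by
  rw [← pair_apply_left hxy h₁, h, pair_apply_left hxy]

/-- A conjugacy maps the unitary of `h` at `e₁`, `-h` at `0` to a multiple of the unitary of `φ(h)`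
at `e₁`, `-φ(h)` at `0`, for a homomorphism `φ`. -/
theorem IsConjugacy.exists_addMonoidHom (hπ : IsConjugacy μA χA μB χB π) :
    ∃ φ : A →+ B, ∀ h, ∃ c : Circle,
      π (μA.tilde.u (pair e₁ 0 h)) = (c : ℂ) • μB.tilde.u (pair e₁ 0 (φ h)) := by
  choose φ c hφ using hπ.exists_map_u_pair
  refine ⟨AddMonoidHom.mk' φ fun h₁ h₂ => pair_injective e₁_ne_zero ?_, fun h => ⟨c h, hφ h⟩⟩
  have h := map_u_add (hφ h₁) (hφ h₂)
  rw [← map_add, ← map_add, hφ] at h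
  exact (smul_u_inj h).1

/-- A conjugacy is induced by a homomorphism. -/
theorem IsConjugacy.exists_map_u (hπ : IsConjugacy μA χA μB χB π) :
    ∃ φ : A →+ B, ∀ l, ∃ c : Circle,
      π (μA.tilde.u l) = (c : ℂ) • μB.tilde.u (Lambda.map φ l) := by
  obtain ⟨φ, hφ⟩ := hπ.exists_addMonoidHom
  refine ⟨φ, ?_⟩
  let S : AddSubmonoid (Lambda A) :=
    { carrier := {l | ∃ c : Circle, π (μA.tilde.u l) = (c : ℂ) • μB.tilde.u (Lambda.map φ l)}
      zero_mem' := ⟨1, by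
        rw [map_zero, u_zero, u_zero, Circle.coe_one, one_smul]
        exact map_one π⟩
      add_mem' := by
        rintro l₁ l₂ ⟨c₁, h₁⟩ ⟨c₂, h₂⟩
        rw [Set.mem_ofPred_eq, map_add]
        exact ⟨_, map_u_add h₁ h₂⟩ }
  refine Lambda.mem_of_pair_mem S ?_ fun h => ?_
  · rintro g l ⟨c, hc⟩
    change ∃ c : Circle, _
    rw [map_shift]
    exact ⟨_, hπ.map_u_shift hc g⟩
  · obtain ⟨c, hc⟩ := hφ h
    exact ⟨c, by rw [hc, map_pair]⟩

/-- If `π` and `π⁻¹` are induced by homomorphisms `φ` and `ψ`, then `ψ ∘ φ` is the identity. -/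
theorem leftInverse_of_map_u {φ : A →+ B} {ψ : B →+ A}
    (hφ : ∀ l, ∃ c : Circle, π (μA.tilde.u l) = (c : ℂ) • μB.tilde.u (Lambda.map φ l))
    (hψ : ∀ l, ∃ c : Circle, π.symm (μB.tilde.u l) = (c : ℂ) • μA.tilde.u (Lambda.map ψ l)) :
    Function.LeftInverse ψ φ := fun h => by
  obtain ⟨c, hc⟩ := hφ (pair e₁ 0 h)
  obtain ⟨d, hd⟩ := hψ (Lambda.map φ (pair e₁ 0 h))
  have h1 := congrArg π.symm hc
  have h2 := π.symm_apply_apply (μA.tilde.u (pair e₁ 0 h))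
  rw [h1, map_smul_u, hd, circle_smul_smul, map_pair, map_pair] at h2
  rw [← one_smul ℂ (μA.tilde.u (pair e₁ 0 h)), ← Circle.coe_one] at h2
  exact pair_injective e₁_ne_zero (smul_u_inj h2).1

/-- A conjugacy is induced by an isomorphism. -/
theorem IsConjugacy.exists_inducedBy (hπ : IsConjugacy μA χA μB χB π) :
    ∃ φ : A ≃+ B, InducedBy μA μB π φ := by
  obtain ⟨φ, hφ⟩ := hπ.exists_map_u
  obtain ⟨ψ, hψ⟩ := hπ.symm.exists_map_u
  have h : ∀ l, ∃ c : Circle, π.symm.symm (μA.tilde.u l) = (c : ℂ) • μB.tilde.u (Lambda.map φ l) :=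
    hφ
  exact ⟨{ φ with
    toFun := φ
    invFun := ψ
    left_inv := leftInverse_of_map_u hφ hψ
    right_inv := leftInverse_of_map_u hψ h }, hφ⟩

end Conjugacy

/-! ### The invariants of a conjugacy -/

section Invariants

variable {A B : Type*} [AddCommGroup A] [AddCommGroup B]

theorem tilde_pair_pair_left (μ : Cocycle A) {x y z : Z2} (hxy : x ≠ y) (hxz : x ≠ z)
    (hyz : y ≠ z) (h k : A) : μ.tilde (pair x y h) (pair x z k) = μ h k := by
  refine (finprod_eq_single _ x fun m hm => ?_).trans ?_
  · by_cases hy : m = y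
    · have hz : (pair x z k).1 m = 0 := pair_apply_ne hm (fun hz => hyz (hy.symm.trans hz)) k
      rw [hz, μ.zero_right']
    · rw [pair_apply_ne hm hy, μ.zero_left']
  · rw [pair_apply_left hxy, pair_apply_left hxz]

theorem tilde_pair_pair_mid (μ : Cocycle A) {x y z : Z2} (hxy : x ≠ y) (hxz : x ≠ z)
    (hyz : y ≠ z) (h k : A) : μ.tilde (pair x y h) (pair y z k) = μ (-h) k := by
  refine (finprod_eq_single _ y fun m hm => ?_).trans ?_
  · by_cases hx : m = x
    · have hz : (pair y z k).1 m = 0 := pair_apply_ne hm (fun hz => hxz (hx.symm.trans hz)) k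
      rw [hz, μ.zero_right']
    · rw [pair_apply_ne hx hm, μ.zero_left']
  · rw [pair_apply_right hxy, pair_apply_left hyz]

theorem phase_inr (χ : AddChar A Circle) (γ : SL(2, ℤ)) (l : Lambda A) :
    phase χ ⟨1, γ⟩ l = 1 := by
  rw [phase_eq]
  simp [det]

/-- The quarter turn about `0` which maps `e₁` to `e₂`. -/
def quarterTurn : G := ⟨1, rotation⟩

theorem affine_quarterTurn_zero : affine quarterTurn 0 = 0 := by
  rw [affine_apply, smul_zero, add_zero]
  rfl

theorem affine_quarterTurn_e₁ : affine quarterTurn e₁ = e₂ := by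
  rw [affine_apply]
  exact (zero_add _).trans rotation_smul_e₁

theorem shift_quarterTurn_left (h : A) : shift quarterTurn (pair e₁ 0 h) = pair e₂ 0 h := by
  rw [shift_pair, affine_quarterTurn_zero, affine_quarterTurn_e₁]

theorem shift_quarterTurn_right (h : A) : shift quarterTurn (pair 0 e₁ h) = pair 0 e₂ h := by
  rw [shift_pair, affine_quarterTurn_zero, affine_quarterTurn_e₁]

/-- The half turn which exchanges `e₁` and `e₂`. -/
def halfTurn : G := ⟨Multiplicative.ofAdd (e₁ + e₂), -1⟩

theorem neg_one_smul_Z2 (m : Z2) : (-1 : SL(2, ℤ)) • m = -m := by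
  ext i
  rw [sl_smul_apply]
  fin_cases i <;> simp

theorem affine_halfTurn_e₁ : affine halfTurn e₁ = e₂ := by
  rw [halfTurn, affine_mk, neg_one_smul_Z2]
  abel

theorem affine_halfTurn_e₂ : affine halfTurn e₂ = e₁ := by
  rw [halfTurn, affine_mk, neg_one_smul_Z2]
  abel

theorem shift_halfTurn (h : A) : shift halfTurn (pair e₁ e₂ h) = pair e₂ e₁ h := by
  rw [shift_pair, affine_halfTurn_e₁, affine_halfTurn_e₂]

theorem phase_halfTurn (χ : AddChar A Circle) (h : A) :
    phase χ halfTurn (pair e₁ e₂ h) = χ h ^ 2 := by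
  have hl : halfTurn.left.toAdd = e₁ + e₂ := rfl
  have hr : halfTurn.right = -1 := rfl
  rw [phase_eq, hl, hr, finprod_eq_prod_of_mulSupport_subset (s := {e₁, e₂}),
    Finset.prod_pair e₁_ne_e₂, pair_apply_left e₁_ne_e₂, pair_apply_right e₁_ne_e₂,
    neg_one_smul_Z2, neg_one_smul_Z2, AddChar.map_neg_eq_inv]
  · have d1 : det (e₁ + e₂) (-e₁) = 1 := by simp [det, e₁, e₂]
    have d2 : det (e₁ + e₂) (-e₂) = -1 := by simp [det, e₁, e₂]
    rw [d1, d2, zpow_one, zpow_neg_one, inv_inv, sq]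
  · intro m hm
    by_contra hne
    rw [Finset.coe_pair, Set.mem_insert_iff, Set.mem_singleton_iff, not_or] at hne
    exact hm (by simp [pair_apply_ne hne.1 hne.2])

variable {μA : Cocycle A} {χA : AddChar A Circle} {μB : Cocycle B} {χB : AddChar B Circle}
  {π : N μA ≃⋆ₐ[ℂ] N μB}

theorem IsConjugacy.map_u_of_shift_eq (hπ : IsConjugacy μA χA μB χB π) {l l' : Lambda A}
    {σ σ' : Lambda B} {c a b : Circle} (h : π (μA.tilde.u l) = (c : ℂ) • μB.tilde.u σ) {g : G}
    (hl : shift g l = l') (hσ : shift g σ = σ') (ha : phase χA g l = a) (hb : phase χB g σ = b) :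
    π (μA.tilde.u l') = ((a⁻¹ * (c * b) : Circle) : ℂ) • μB.tilde.u σ' := by
  subst hl hσ ha hb
  exact hπ.map_u_shift h g

/-- The quotient of `μ` by the pull back of `ν`. -/
def Cocycle.divComp (μ : Cocycle A) (ν : Cocycle B) (φ : A →+ B) : Cocycle A where
  toFun g h := μ g h * (ν (φ g) (φ h))⁻¹
  cocycle' g h k := by
    have h1 := μ.cocycle' g h k
    have h2 := ν.cocycle' (φ g) (φ h) (φ k)
    rw [← map_add, ← map_add] at h2
    rw [mul_mul_mul_comm, h1, ← mul_inv, h2, mul_inv, mul_mul_mul_comm]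
  zero_left' g := by rw [map_zero, μ.zero_left', ν.zero_left', inv_one, one_mul]
  zero_right' g := by rw [map_zero, μ.zero_right', ν.zero_right', inv_one, one_mul]

/-- If an isomorphism is induced by `φ`, then `μ_a` and `μ_b ∘ φ` are cohomologous: on the elements
of `Λ(H)` supported on `{0, e₁}` and `{0, e₂}` only the value at `0` enters `μ̃`, so that the quotient
of the two cocycles is symmetric. -/
theorem InducedBy.cohomologous {φ : A ≃+ B} (hφ : InducedBy μA μB π φ) :
    Cohomologous (fun g h => μA g h) (fun g h => μB (φ g) (φ h)) := by
  have symm : ∀ g h, μA.divComp μB φ.toAddMonoidHom g h = μA.divComp μB φ.toAddMonoidHom h g := by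
    intro g h
    obtain ⟨c₁, h₁⟩ := hφ (pair 0 e₁ g)
    obtain ⟨c₂, h₂⟩ := hφ (pair 0 e₂ h)
    have r₁ := map_u_add h₁ h₂
    have r₂ := map_u_add h₂ h₁
    rw [add_comm (pair 0 e₂ h), add_comm (Lambda.map _ (pair 0 e₂ h))] at r₂
    have r := (smul_u_inj (r₁.symm.trans r₂)).2
    rw [map_pair, map_pair,
      tilde_pair_pair_left _ e₁_ne_zero.symm e₂_ne_zero.symm e₁_ne_e₂,
      tilde_pair_pair_left _ e₁_ne_zero.symm e₂_ne_zero.symm e₁_ne_e₂,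
      tilde_pair_pair_left _ e₂_ne_zero.symm e₁_ne_zero.symm e₁_ne_e₂.symm,
      tilde_pair_pair_left _ e₂_ne_zero.symm e₁_ne_zero.symm e₁_ne_e₂.symm, mul_comm c₂,
      mul_left_comm, mul_left_comm _ (c₁ * c₂)] at r
    have r' := congrArg (fun z => z⁻¹) (mul_left_cancel r)
    simp only [mul_inv, inv_inv] at r'
    exact r'
  obtain ⟨b, hb⟩ := Cocycle.exists_coboundary _ symm
  refine ⟨b, fun g h => ?_⟩
  rw [← hb]
  exact (inv_mul_cancel_right _ _).symm

/-- If a conjugacy is induced by `φ`, then `χ_a² = (χ_b ∘ φ)²`: the edge `e₁, e₂` is the sum of the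
edges `e₁, 0` and `0, e₂`, and a rotation about `0` maps it to the opposite edge without any scalars,
whereas the half turn about the midpoint of `e₁, e₂` does so with the scalars `χ_a²` and `χ_b²`. -/
theorem IsConjugacy.sq_eq (hπ : IsConjugacy μA χA μB χB π) {φ : A ≃+ B}
    (hφ : InducedBy μA μB π φ) : χA ^ 2 = (χB.compAddMonoidHom φ.toAddMonoidHom) ^ 2 := by
  ext1 h
  rw [AddChar.pow_apply, AddChar.pow_apply, AddChar.compAddMonoidHom_apply]
  obtain ⟨c₁, h₁⟩ := hφ (pair e₁ 0 h)
  obtain ⟨c₂, h₂⟩ := hφ (pair 0 e₁ h)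
  rw [map_pair] at h₁ h₂
  have h₁' := hπ.map_u_of_shift_eq h₁ (shift_quarterTurn_left h)
    (shift_quarterTurn_left _) (phase_inr χA _ _) (phase_inr χB _ _)
  have h₂' := hπ.map_u_of_shift_eq h₂ (shift_quarterTurn_right h)
    (shift_quarterTurn_right _) (phase_inr χA _ _) (phase_inr χB _ _)
  rw [inv_one, one_mul, mul_one] at h₁' h₂'
  have h₃ := map_u_add h₁ h₂'
  have h₄ := map_u_add h₁' h₂
  rw [pair_add_pair, pair_add_pair,
    tilde_pair_pair_mid _ e₁_ne_zero e₁_ne_e₂ e₂_ne_zero.symm,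
    tilde_pair_pair_mid _ e₁_ne_zero e₁_ne_e₂ e₂_ne_zero.symm] at h₃
  rw [pair_add_pair, pair_add_pair,
    tilde_pair_pair_mid _ e₂_ne_zero e₁_ne_e₂.symm e₁_ne_zero.symm,
    tilde_pair_pair_mid _ e₂_ne_zero e₁_ne_e₂.symm e₁_ne_zero.symm] at h₄
  have h₅ := hπ.map_u_of_shift_eq h₃ (shift_halfTurn h) (shift_halfTurn _) (phase_halfTurn χA h)
    (phase_halfTurn χB _)
  have r := (smul_u_inj (h₄.symm.trans h₅)).2
  rw [mul_left_comm (χA h ^ 2)⁻¹, left_eq_mul, inv_mul_eq_one] at r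
  exact r

end Invariants

/-! ### Spatial isomorphisms of twisted group von Neumann algebras -/

section Spatial

variable {Γ Γ' : Type*}

theorem memLp_monomialEquiv (e : Γ ≃ Γ') (c : Γ → Circle) (f : L2 Γ) :
    Memℓp (fun x => (c (e.symm x) : ℂ) * f (e.symm x)) 2 := by
  have hf := lp.memℓp f
  rw [memℓp_gen_iff (by norm_num)] at hf ⊢
  simp only [norm_mul, Circle.norm_coe, one_mul]
  exact (e.symm.summable_iff (f := fun i => ‖f i‖ ^ (2 : ENNReal).toReal)).2 hf

/-- The unitary `ℓ²(Γ) → ℓ²(Γ')` with `δ_g ↦ c(g) δ_{e(g)}`, for a bijection `e` and a function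
`c : Γ → 𝕋`. -/
def monomialEquiv (e : Γ ≃ Γ') (c : Γ → Circle) : L2 Γ ≃ₗᵢ[ℂ] L2 Γ' where
  toFun f := ⟨fun x => (c (e.symm x) : ℂ) * f (e.symm x), memLp_monomialEquiv e c f⟩
  invFun f := ⟨fun x => ((c x)⁻¹ : Circle) * f (e x), by
    have h := memLp_monomialEquiv e.symm (fun x => (c (e.symm x))⁻¹) f
    simp only [Equiv.symm_symm, Equiv.symm_apply_apply] at h
    exact h⟩
  left_inv f := by
    ext x
    simp
  right_inv f := by
    ext x
    simp
  map_add' f g := by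
    ext x
    exact mul_add _ _ _
  map_smul' a f := by
    ext x
    exact mul_left_comm _ _ _
  norm_map' f := by
    have h : (0 : ℝ) < (2 : ENNReal).toReal := by norm_num
    refine (Real.rpow_left_injOn h.ne').eq_iff (norm_nonneg _) (norm_nonneg _) |>.1 ?_
    dsimp only
    rw [lp.norm_rpow_eq_tsum h, lp.norm_rpow_eq_tsum h]
    simp only [LinearEquiv.coe_mk, LinearMap.coe_mk, AddHom.coe_mk, norm_mul, Circle.norm_coe,
      one_mul]
    exact e.symm.tsum_eq (fun i => ‖f i‖ ^ (2 : ENNReal).toReal)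

theorem monomialEquiv_apply (e : Γ ≃ Γ') (c : Γ → Circle) (f : L2 Γ) (x : Γ') :
    monomialEquiv e c f x = (c (e.symm x) : ℂ) * f (e.symm x) := rfl

/-- Conjugation by `δ_g ↦ c(g) δ_{e(g)}` maps `δ_g ↦ a(g) δ_{p(g)}` to `δ_g ↦ a'(g) δ_{p'(g)}`. -/
theorem conj_monomial (e : Γ ≃ Γ') (c : Γ → Circle) {p : Equiv.Perm Γ} {p' : Equiv.Perm Γ'}
    {a : Γ → Circle} {a' : Γ' → Circle} (hp : ∀ y, e (p y) = p' (e y))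
    (ha : ∀ y, c (p y) * a y = a' (e y) * c y) :
    (monomialEquiv e c).conjStarAlgEquiv (monomial p a : L2 Γ →L[ℂ] L2 Γ) =
      (monomial p' a' : L2 Γ' →L[ℂ] L2 Γ') := by
  refine ContinuousLinearMap.ext fun f => ?_
  obtain ⟨f, rfl⟩ := (monomialEquiv e c).surjective f
  rw [LinearIsometryEquiv.conjStarAlgEquiv_apply_apply, LinearIsometryEquiv.symm_apply_apply]
  refine lp.ext (funext fun x => ?_)
  obtain ⟨x, rfl⟩ := e.surjective x
  obtain ⟨x, rfl⟩ := p.surjective x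
  rw [monomialEquiv_apply, monomial_apply, monomial_apply, hp, Equiv.symm_apply_apply,
    monomialEquiv_apply, ← hp, Equiv.symm_apply_apply, Equiv.symm_apply_apply,
    Equiv.symm_apply_apply, ← mul_assoc, ← mul_assoc, ← Circle.coe_mul, ← Circle.coe_mul, ha]

theorem smul_monomial (s : Circle) (p : Equiv.Perm Γ) (a : Γ → Circle) :
    (s : ℂ) • (monomial p a : L2 Γ →L[ℂ] L2 Γ) =
      (monomial p (fun x => s * a x) : L2 Γ →L[ℂ] L2 Γ) := by
  refine ContinuousLinearMap.ext fun f => lp.ext (funext fun x => ?_)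
  change (s : ℂ) * (monomial p a).1 f x = _
  rw [monomial_apply, monomial_apply, Circle.coe_mul, mul_assoc]

variable [AddCommGroup Γ] [AddCommGroup Γ'] {μ : Cocycle Γ} {ν : Cocycle Γ'}

/-- A `*`-isomorphism `B(ℓ²(Γ)) → B(ℓ²(Γ'))` which maps the generators of `L_μ(Γ)` to multiples of
generators of `L_ν(Γ')` maps `L_μ(Γ)` into `L_ν(Γ')`: its inverse maps the commutant of the latter
generators into the commutant of the former. -/
theorem Cocycle.map_mem_of_equiv (Φ : (L2 Γ →L[ℂ] L2 Γ) ≃⋆ₐ[ℂ] (L2 Γ' →L[ℂ] L2 Γ'))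
    (hΦ : ∀ γ, ∃ (c : ℂ) (γ' : Γ'), Φ (μ.translation γ : L2 Γ →L[ℂ] L2 Γ)
      = c • (ν.translation γ' : L2 Γ' →L[ℂ] L2 Γ'))
    {x : L2 Γ →L[ℂ] L2 Γ} (hx : x ∈ μ.vN.toStarSubalgebra) : Φ x ∈ ν.vN.toStarSubalgebra := by
  have key : ∀ y ∈ StarSubalgebra.centralizer ℂ ν.translations,
      Φ.symm y ∈ StarSubalgebra.centralizer ℂ μ.translations := by
    intro y hy
    refine (StarSubalgebra.mem_centralizer_iff ℂ).2 ?_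
    rintro _ ⟨γ, rfl⟩
    obtain ⟨c, γ', h⟩ := hΦ γ
    have h' := (StarSubalgebra.mem_centralizer_iff ℂ).1 hy _ ⟨γ', rfl⟩
    constructor
    · refine (EquivLike.injective Φ) ?_
      dsimp only at h' ⊢
      rw [map_mul, map_mul, h, StarAlgEquiv.apply_symm_apply, smul_mul_assoc, h'.1, mul_smul_comm]
    · refine (EquivLike.injective Φ) ?_
      dsimp only at h' ⊢
      rw [map_mul, map_mul, map_star, h, StarAlgEquiv.apply_symm_apply, star_smul, smul_mul_assoc,
        h'.2, mul_smul_comm]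
  have comm : ∀ y ∈ StarSubalgebra.centralizer ℂ ν.translations, y * Φ x = Φ x * y := by
    intro y hy
    have := congrArg Φ ((StarSubalgebra.mem_centralizer_iff ℂ).1 hx _ (key y hy)).1
    simpa only [map_mul, StarAlgEquiv.apply_symm_apply] using this
  exact (StarSubalgebra.mem_centralizer_iff ℂ).2 fun y hy => ⟨comm y hy, comm _ (star_mem hy)⟩

/-- The restriction `L_μ(Γ) → L_ν(Γ')` of a `*`-isomorphism `B(ℓ²(Γ)) → B(ℓ²(Γ'))` which maps the
unitaries `u(γ)` to multiples of the unitaries `v(e(γ))`. -/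
def Cocycle.restrictEquiv (Φ : (L2 Γ →L[ℂ] L2 Γ) ≃⋆ₐ[ℂ] (L2 Γ' →L[ℂ] L2 Γ')) (e : Γ ≃ Γ')
    (c : Γ → Circle) (hΦ : ∀ γ, Φ (μ.translation γ : L2 Γ →L[ℂ] L2 Γ)
      = (c γ : ℂ) • (ν.translation (e γ) : L2 Γ' →L[ℂ] L2 Γ')) : μ.Alg ≃⋆ₐ[ℂ] ν.Alg where
  toFun x := ⟨Φ x.1, Cocycle.map_mem_of_equiv Φ (fun γ => ⟨_, _, hΦ γ⟩) x.2⟩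
  invFun x := ⟨Φ.symm x.1, Cocycle.map_mem_of_equiv Φ.symm (fun γ => by
    refine ⟨((c (e.symm γ))⁻¹ : Circle), e.symm γ, EquivLike.injective Φ ?_⟩
    rw [map_smul, hΦ, StarAlgEquiv.apply_symm_apply, circle_smul_smul, inv_mul_cancel,
      Circle.coe_one, one_smul, Equiv.apply_symm_apply]) x.2⟩
  left_inv x := Subtype.ext (Φ.symm_apply_apply x.1)
  right_inv x := Subtype.ext (Φ.apply_symm_apply x.1)
  map_mul' x y := Subtype.ext (map_mul Φ x.1 y.1)
  map_add' x y := Subtype.ext (map_add Φ x.1 y.1)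
  map_star' x := Subtype.ext (map_star Φ x.1)
  map_smul' c x := Subtype.ext (map_smul Φ c x.1)

end Spatial

/-! ### The quadratic form `q² + qr + r²` modulo `2` -/

/-- The quadratic form `m₀² + m₀ m₁ + m₁²` on `ℤ²`. Modulo `2` it is invariant under `SL(2, ℤ)`, and
its polar form is the determinant. -/
def quad (m : Z2) : ℤ := m 0 ^ 2 + m 0 * m 1 + m 1 ^ 2

theorem two_dvd_quad_affine (k m : Z2) (γ : SL(2, ℤ)) :
    (2 : ℤ) ∣ quad (k + γ • m) + det k (γ • m) - (quad m + quad k) := by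
  have key : ∀ a b c d x y u v : ZMod 2, a * d - b * c = 1 →
      (u + (a * x + b * y)) ^ 2 + (u + (a * x + b * y)) * (v + (c * x + d * y)) +
        (v + (c * x + d * y)) ^ 2 + (u * (c * x + d * y) - v * (a * x + b * y)) -
        (x ^ 2 + x * y + y ^ 2 + (u ^ 2 + u * v + v ^ 2)) = 0 := by
    decide
  have hγ := γ.det_coe
  rw [Matrix.det_fin_two] at hγ
  have hγ' := congrArg (Int.cast : ℤ → ZMod 2) hγ
  push_cast at hγ'
  refine (ZMod.intCast_zmod_eq_zero_iff_dvd _ 2).1 ?_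
  simp only [quad, det, Pi.add_apply, sl_smul_apply]
  push_cast
  exact key _ _ _ _ _ _ _ _ hγ'

theorem zpow_eq_zpow_of_two_dvd {z : Circle} (hz : z ^ 2 = 1) {a b : ℤ} (h : 2 ∣ a - b) :
    z ^ a = z ^ b := by
  obtain ⟨t, ht⟩ := h
  rw [eq_add_of_sub_eq ht, zpow_add, zpow_mul, zpow_ofNat, hz, one_zpow, one_mul]

/-! ### Construction of a conjugacy -/

section Construction

variable {A B : Type*} [AddCommGroup A] [AddCommGroup B]

theorem mulSupport_finite (F : Z2 → A → Circle) (hF : ∀ m, F m 0 = 1) (l : Lambda A) :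
    (Function.mulSupport fun m => F m (l.1 m)).Finite := by
  refine l.1.hasFiniteSupport.subset fun m hm h0 => hm ?_
  have h0' : l.1 m = 0 := h0
  simp [h0', hF]

/-- The isomorphism `Λ(A) → Λ(B)` induced by an isomorphism `φ`. -/
def Lambda.mapEquiv (φ : A ≃+ B) : Lambda A ≃ Lambda B where
  toFun := Lambda.map φ.toAddMonoidHom
  invFun := Lambda.map φ.symm.toAddMonoidHom
  left_inv l := by
    ext k
    exact φ.symm_apply_apply _
  right_inv l := by
    ext k
    exact φ.apply_symm_apply _

/-- The scalars `∏_m b(λ(m)) θ(λ(m))^{q(m)}` of a conjugacy, where `q` is the quadratic form `quad`.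
The factor `b` trivializes the quotient of the cocycles and the factor `θ^q` the quotient of the
characters. -/
def gauge (b : A → Circle) (θ : AddChar A Circle) (l : Lambda A) : Circle :=
  ∏ᶠ m : Z2, b (l.1 m) * θ (l.1 m) ^ quad m

variable {b : A → Circle} {θ : AddChar A Circle}

theorem gauge_add (hb : b 0 = 1) {φ : A ≃+ B} {μA : Cocycle A} {μB : Cocycle B}
    (hμ : ∀ g h, μA g h = b g * b h * (b (g + h))⁻¹ * μB (φ g) (φ h)) (l₁ l₂ : Lambda A) :
    gauge b θ (l₁ + l₂) * μA.tilde l₁ l₂ =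
      gauge b θ l₁ * μB.tilde (Lambda.mapEquiv φ l₁) (Lambda.mapEquiv φ l₂) * gauge b θ l₂ := by
  have fin : ∀ l : Lambda A,
      (Function.mulSupport fun m => b (l.1 m) * θ (l.1 m) ^ quad m).Finite := fun l =>
    mulSupport_finite (fun m x => b x * θ x ^ quad m) (by simp [hb]) l
  have finA : (Function.mulSupport fun m => μA (l₁.1 m) (l₂.1 m)).Finite :=
    mulSupport_finite (fun m x => μA x (l₂.1 m)) (fun m => μA.zero_left' _) l₁
  have finB : (Function.mulSupport fun m => μB (φ (l₁.1 m)) (φ (l₂.1 m))).Finite :=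
    mulSupport_finite (fun m x => μB (φ x) (φ (l₂.1 m)))
      (fun m => by simp only [map_zero]; exact μB.zero_left' _) l₁
  change (∏ᶠ m : Z2, _) * (∏ᶠ m : Z2, μA (l₁.1 m) (l₂.1 m)) =
    (∏ᶠ m : Z2, _) * (∏ᶠ m : Z2, μB (φ (l₁.1 m)) (φ (l₂.1 m))) * (∏ᶠ m : Z2, _)
  rw [← finprod_mul_distrib (fin _) finA, ← finprod_mul_distrib (fin _) finB,
    ← finprod_mul_distrib ?_ (fin _)]
  · refine finprod_congr fun m => ?_
    have hl : (l₁ + l₂).1 m = l₁.1 m + l₂.1 m := rfl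
    rw [hl, hμ, AddChar.map_add_eq_mul, mul_zpow]
    generalize b (l₁.1 m + l₂.1 m) = x
    calc _ = x * x⁻¹ * (b (l₁.1 m) * b (l₂.1 m) * (θ (l₁.1 m) ^ quad m * θ (l₂.1 m) ^ quad m) *
          μB (φ (l₁.1 m)) (φ (l₂.1 m))) := by ac_rfl
      _ = _ := by rw [mul_inv_cancel, one_mul]; ac_rfl
  · exact ((fin l₁).union finB).subset (Function.mulSupport_mul _ _)

theorem gauge_shift (hb : b 0 = 1) (hθ : ∀ h, θ h ^ 2 = 1) {φ : A ≃+ B} {χA : AddChar A Circle}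
    {χB : AddChar B Circle} (hχ : ∀ h, χA h = θ h * χB (φ h)) (g : G) (l : Lambda A) :
    gauge b θ (shift g l) * phase χA g l = phase χB g (Lambda.mapEquiv φ l) * gauge b θ l := by
  have e1 : gauge b θ (shift g l) =
      ∏ᶠ m : Z2, b (l.1 m) * θ (l.1 m) ^ quad (affine g m) := by
    rw [gauge, ← finprod_comp_equiv (affine g)]
    simp only [shift_apply_affine]
  have e2 : phase χB g (Lambda.mapEquiv φ l) =
      ∏ᶠ m : Z2, χB (φ (l.1 m)) ^ det g.left.toAdd (g.right • m) := phase_eq _ _ _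
  -- `θ^q` changes under `g` by the determinant and the constant `q(k)`, which does not matter
  -- because the values of `l` have sum zero.
  rw [e1, phase_eq, e2, gauge, ← mul_one ((∏ᶠ m : Z2, _) * (∏ᶠ m : Z2, b (l.1 m) * _)),
    ← prod_char θ l (quad g.left.toAdd),
    ← finprod_mul_distrib (mulSupport_finite (fun m x => b x * θ x ^ quad (affine g m))
      (by simp [hb]) l) (twist_finite _ _ _),
    ← finprod_mul_distrib (mulSupport_finite (fun m x =>
      χB (φ x) ^ det g.left.toAdd (g.right • m)) (by simp) l)
      (mulSupport_finite (fun m x => b x * θ x ^ quad m) (by simp [hb]) l),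
    ← finprod_mul_distrib (mulSupport_finite (fun m x =>
      χB (φ x) ^ det g.left.toAdd (g.right • m) * (b x * θ x ^ quad m)) (by simp [hb]) l)
      (twist_finite _ _ _)]
  refine finprod_congr fun m => ?_
  have hq := zpow_eq_zpow_of_two_dvd (hθ (l.1 m)) (two_dvd_quad_affine g.left.toAdd m g.right)
  rw [zpow_add, zpow_add] at hq
  rw [hχ, mul_zpow, affine_apply]
  rw [mul_assoc, ← mul_assoc (θ (l.1 m) ^ quad (g.left.toAdd + g.right • m)), hq, ← mul_assoc,
    ← mul_assoc (b (l.1 m)), mul_comm _ (χB (φ (l.1 m)) ^ det g.left.toAdd (g.right • m)),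
    ← mul_assoc]

/-- If `μ_a` and `μ_b ∘ φ` are cohomologous and `χ_a² = (χ_b ∘ φ)²`, then there is a conjugacy induced
by `φ`. It is implemented by the unitary `δ_λ ↦ c(λ) δ_{φ ∘ λ}`, with `c` the scalars `gauge`. -/
theorem exists_isConjugacy {φ : A ≃+ B} {μA : Cocycle A} {χA : AddChar A Circle} {μB : Cocycle B}
    {χB : AddChar B Circle}
    (hμ : Cohomologous (fun g h => μA g h) (fun g h => μB (φ g) (φ h)))
    (hχ : χA ^ 2 = (χB.compAddMonoidHom φ.toAddMonoidHom) ^ 2) :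
    ∃ π : N μA ≃⋆ₐ[ℂ] N μB, IsConjugacy μA χA μB χB π ∧ InducedBy μA μB π φ := by
  obtain ⟨b, hb⟩ : ∃ b : A → Circle,
      ∀ g h, μA g h = b g * b h * (b (g + h))⁻¹ * μB (φ g) (φ h) := hμ
  have hb0 : b 0 = 1 := by
    have h := hb 0 0
    rw [map_zero φ, μA.zero_left', μB.zero_left', add_zero, mul_inv_cancel_right, mul_one] at h
    exact h.symm
  let θ : AddChar A Circle :=
    { toFun := fun h => χA h * (χB (φ h))⁻¹
      map_zero_eq_one' := by simp
      map_add_eq_mul' := fun g h => by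
        rw [map_add φ, AddChar.map_add_eq_mul, AddChar.map_add_eq_mul, mul_inv, mul_mul_mul_comm] }
  have hθ : ∀ h, θ h ^ 2 = 1 := fun h => by
    have h1 : χA h ^ 2 = χB (φ h) ^ 2 := DFunLike.congr_fun hχ h
    change (χA h * (χB (φ h))⁻¹) ^ 2 = 1
    rw [mul_pow, h1, inv_pow, mul_inv_cancel]
  have hχ' : ∀ h, χA h = θ h * χB (φ h) := fun h => (inv_mul_cancel_right _ _).symm
  let Φ := (monomialEquiv (Lambda.mapEquiv φ) (gauge b θ)).conjStarAlgEquiv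
  have hΦ : ∀ l, Φ (μA.tilde.translation l : L2 (Lambda A) →L[ℂ] L2 (Lambda A)) =
      (gauge b θ l : ℂ) •
        (μB.tilde.translation (Lambda.mapEquiv φ l) : L2 (Lambda B) →L[ℂ] L2 (Lambda B)) := by
    intro l
    rw [Cocycle.translation, Cocycle.translation, smul_monomial]
    exact conj_monomial _ _ (fun l' => map_add (Lambda.map φ.toAddMonoidHom) l l')
      fun l' => gauge_add hb0 hb l l'
  have hW : ∀ g, Φ (implement χA g : L2 (Lambda A) →L[ℂ] L2 (Lambda A)) =
      (implement χB g : L2 (Lambda B) →L[ℂ] L2 (Lambda B)) := fun g =>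
    conj_monomial _ _ (fun l => map_shift φ.toAddMonoidHom g l)
      fun l => gauge_shift hb0 hθ hχ' g l
  refine ⟨Cocycle.restrictEquiv Φ (Lambda.mapEquiv φ) (gauge b θ) hΦ, fun g x => Subtype.ext ?_,
    fun l => ⟨gauge b θ l, Subtype.ext (hΦ l)⟩⟩
  change Φ ((implement χA g).1 * x.1 * star (implement χA g).1) =
    (implement χB g).1 * Φ x.1 * star (implement χB g).1
  rw [map_mul, map_mul, map_star, hW]

end Construction

end TwistedBernoulli

end

theorem theorem4p1 {Ha Hb : Type*} [AddCommGroup Ha] [Countable Ha] [AddCommGroup Hb] [Countable Hb]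
    (μa : TwistedBernoulli.Cocycle Ha) (χa : AddChar Ha Circle)
    (μb : TwistedBernoulli.Cocycle Hb) (χb : AddChar Hb Circle) :
    (∀ π : TwistedBernoulli.N μa ≃⋆ₐ[ℂ] TwistedBernoulli.N μb,
      TwistedBernoulli.IsConjugacy μa χa μb χb π →
      ∃ φ : Ha ≃+ Hb,
        TwistedBernoulli.InducedBy μa μb π φ ∧
        TwistedBernoulli.Cohomologous (fun g h => μa g h) (fun g h => μb (φ g) (φ h)) ∧
        χa ^ 2 = (χb.compAddMonoidHom φ.toAddMonoidHom) ^ 2) ∧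
    (∀ φ : Ha ≃+ Hb,
      TwistedBernoulli.Cohomologous (fun g h => μa g h) (fun g h => μb (φ g) (φ h)) →
      χa ^ 2 = (χb.compAddMonoidHom φ.toAddMonoidHom) ^ 2 →
      ∃ π : TwistedBernoulli.N μa ≃⋆ₐ[ℂ] TwistedBernoulli.N μb,
        TwistedBernoulli.IsConjugacy μa χa μb χb π ∧
        TwistedBernoulli.InducedBy μa μb π φ) := by
  refine ⟨fun π hπ => ?_, fun φ hμ hχ => TwistedBernoulli.exists_isConjugacy hμ hχ⟩
  obtain ⟨φ, hφ⟩ := hπ.exists_inducedBy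
  exact ⟨φ, hφ, hφ.cohomologous, hπ.sq_eq hφ⟩
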